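/- For probability distributions $p,q$ on $\mathbb{R}^d$ (with the Borel $\sigma$-algebra) write $\|p-q\|_1 = 2\sup_{B}|p(B)-q(B)|$, the supremum over Borel sets $B$ (if $p,q$ have densities this is the $L_1$ distance of the densities). For a class $\mathcal{G}$ of distributions and a distribution $g$ let $\mathrm{opt}(\mathcal{G},g)=\inf_{f\in\mathcal{G}}\|f-g\|_1$. A learner is a (measurable) map that, given $\varepsilon,\delta>0$ and a finite sample of points of $\mathbb{R}^d$, outputs a probability distribution on $\mathbb{R}^d$. It is a $C$-agnostic PAC-learner for $\mathcal{G}$ with sample complexity $m(\varepsilon,\delta)$ if, for every probability distribution $g$ on $\mathbb{R}^d$ (not necessarily in $\mathcal{G}$) and all $\varepsilon,\delta>0$, given $\varepsilon$, $\delta$ and $m(\varepsilon,\delta)$ i.i.d. samples from $g$, with probability at least $1-\delta$ it outputs $\hat g$ with $\|\hat g-g\|_1\le C\cdot\mathrm{opt}(\mathcal{G},g)+\varepsilon$. It is a realizable PAC-learner for $\mathcal{G}$ with sample complexity $m(\varepsilon,\delta)$ if, for every $g\in\mathcal{G}$ and all $\varepsilon,\delta>0$, with probability at least $1-\delta$ it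 outputs $\hat g$ with $\|\hat g-g\|_1\le\varepsilon$. **Theorem.** There is a universal constant $K>0$ such that the following holds for all integers $d\ge1$ and $k\ge2$. Let $\mathcal{F}$ be the class of all Gaussian distributions $\mathcal{N}(\mu,\Sigma)$ on $\mathbb{R}^d$ with $\mu\in\mathbb{R}^d$ and $\Sigma$ symmetric positive definite, and let $\mathcal{F}^k$ be the class of all mixtures $\sum_{i=1}^k w_if_i$ with $f_i\in\mathcal{F}$, $w_i\ge0$, $\sum_i w_i=1$. Then there is a $9$-agnostic PAC-learner for $\mathcal{F}^k$ whose sample complexity satisfies $$m(\varepsilon,\delta)\le K\,\frac{k\,d^2\,\log k\,\log(k/\delta)}{\varepsilon^4}\qquad\text{for all }\varepsilon>0\text{ and }0<\delta<1 .$$ The same learner, with the same number of samples, is also a realizable PAC-learner for $\mathcal{F}^k$. -/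

import Mathlib

open MeasureTheory ProbabilityTheory

noncomputable section

namespace DistLearning

variable {X : Type*} [MeasurableSpace X]

/-- Total variation distance: the supremum of `|p B - q B|` over the measurable sets `B`. -/
def tvDist (p q : ProbabilityMeasure X) : ℝ :=
  ⨆ B : {B : Set X // MeasurableSet B},
    |(p : Measure X).real B.1 - (q : Measure X).real B.1|

/-- The `L¹` distance of two probability distributions, which is twice the total variation
distance (and equals `∫ |p - q|` when both have densities). -/
def l1Dist (p q : ProbabilityMeasure X) : ℝ := 2 * tvDist p q

/-- `opt F g` is the infimum of the `L¹` distances from `g` to the members of `F`. -/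
def opt (F : Set (ProbabilityMeasure X)) (g : ProbabilityMeasure X) : ℝ :=
  ⨅ f : F, l1Dist f.1 g

/-- `q` is an `ε`-approximation of `g`. -/
def IsApprox (ε : ℝ) (q g : ProbabilityMeasure X) : Prop := l1Dist q g ≤ ε

/-- `q` is an `(ε, C)`-approximation of `g` with respect to the class `F`. -/
def IsAgnosticApprox (F : Set (ProbabilityMeasure X)) (ε C : ℝ)
    (q g : ProbabilityMeasure X) : Prop :=
  l1Dist q g ≤ C * opt F g + ε

/-- The class of `k`-mixtures `∑ i, w i • f i` of members `f i` of `F`, with weights `w` in the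
standard simplex. -/
def mixtures (F : Set (ProbabilityMeasure X)) (k : ℕ) : Set (ProbabilityMeasure X) :=
  {p | ∃ w ∈ stdSimplex ℝ (Fin k), ∃ f : Fin k → ProbabilityMeasure X, (∀ i, f i ∈ F) ∧
    (p : Measure X) = ∑ i, ENNReal.ofReal (w i) • (f i : Measure X)}

/-- The class of (nondegenerate) Gaussian distributions `N(μ, S)` on `ℝ^d`. -/
def gaussians (d : ℕ) : Set (ProbabilityMeasure (EuclideanSpace ℝ (Fin d))) :=
  {p | ∃ (μ : EuclideanSpace ℝ (Fin d)) (S : Matrix (Fin d) (Fin d) ℝ), S.PosDef ∧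
    (p : Measure (EuclideanSpace ℝ (Fin d))) = multivariateGaussian μ S}

variable (X) in
/-- A distribution learning method: given `ε`, `δ` and a finite sample, it outputs a probability
distribution, which depends measurably on the sample. -/
structure Learner where
  /-- The output on the parameters `ε`, `δ` and a sample of size `n`. -/
  output : ℝ → ℝ → (n : ℕ) → (Fin n → X) → ProbabilityMeasure X
  measurable_output : ∀ (ε δ : ℝ) (n : ℕ), Measurable (output ε δ n)

/-- The law of an i.i.d. sample of size `n` from `g`. -/
def sampleLaw (g : ProbabilityMeasure X) (n : ℕ) : Measure (Fin n → X) :=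
  Measure.pi fun _ => (g : Measure X)

/-- `A` is a `C`-agnostic PAC-learner for `F` with sample complexity `m`: for every distribution
`g`, on `m ε δ` i.i.d. samples from `g`, the (outer) probability that the output fails to be an
`(ε, C)`-approximation of `g` is at most `δ`. -/
def IsAgnosticPACLearner (C : ℝ) (F : Set (ProbabilityMeasure X)) (m : ℝ → ℝ → ℕ)
    (A : Learner X) : Prop :=
  ∀ (g : ProbabilityMeasure X) (ε δ : ℝ), 0 < ε → 0 < δ →
    sampleLaw g (m ε δ) {S | ¬ IsAgnosticApprox F ε C (A.output ε δ (m ε δ) S) g}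
      ≤ ENNReal.ofReal δ

/-- `A` is a realizable PAC-learner for `F` with sample complexity `m`: for every `g ∈ F`, on
`m ε δ` i.i.d. samples from `g`, the (outer) probability that the output fails to be an
`ε`-approximation of `g` is at most `δ`. -/
def IsRealizablePACLearner (F : Set (ProbabilityMeasure X)) (m : ℝ → ℝ → ℕ)
    (A : Learner X) : Prop :=
  ∀ g ∈ F, ∀ ε δ : ℝ, 0 < ε → 0 < δ →
    sampleLaw g (m ε δ) {S | ¬ IsApprox ε (A.output ε δ (m ε δ) S) g} ≤ ENNReal.ofReal δ

end DistLearning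

end

/-! If each sample point came with the index of its mixture component, the problem would be an
ordinary minimum distance estimate on `X × Fin k`. Joint laws of (point, label) have, for each
label, a density that is a multiple of the exponential of a quadratic polynomial. Comparing two such
densities is, label by label, a sign condition on a quadratic, so the Yatracos sets have VC
dimension at most `k (1 + d + d²)` (`exists_yatracos`), and a chaining bound gives uniform deviation
with `n` of order `k d² / ε²` points (`VCBounded.deviation`).

The labels are missing and `g` need not be a mixture. Let `f` be a nearly optimal mixture and `J`
its joint law. Applying the conditional law of the label under `J` to `g` gives a labelled law `P`
with marginal `g`, and `tvDist J P ≤ tvDist f g` (`tvDist_compKernel_le`). A sample of `P` is a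
sample of `g` with random labels, so with probability at least `1/2` over the unlabelled sample some
labelling leads to a good estimate of `P`. Neither `P` nor the labels are known, so all `k ^ n`
labellings are tried; `r` independent blocks reduce the failure probability to `2⁻ʳ`.

A second minimum distance estimate on `m` fresh points selects among the `r k ^ n` marginals
(`exists_twoStage`). Hoeffding's inequality needs `m` of order `ε⁻²` times the logarithm of their
number, that is `n log k`, whence `ε⁻⁴`. Each stage loses a factor `3`, whence `9`. The realizable
case follows because `opt` vanishes on the class. -/

noncomputable section

namespace DistLearning

/-! ### Rademacher averages of set families of bounded VC dimension. -/

section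

open Finset

/-- The sign `±1` of a Boolean. -/
def sgn (b : Bool) : ℝ := if b then 1 else -1

/-- The average over all sign vectors. -/
def signAvg {ι : Type*} [Fintype ι] [DecidableEq ι] (M : (ι → Bool) → ℝ) : ℝ :=
  (∑ σ, M σ) / 2 ^ Fintype.card ι

section signAvg

variable {ι : Type*} [Fintype ι] [DecidableEq ι]

lemma signAvg_mono {M N : (ι → Bool) → ℝ} (h : ∀ σ, M σ ≤ N σ) : signAvg M ≤ signAvg N :=
  div_le_div_of_nonneg_right (sum_le_sum fun σ _ => h σ) (by positivity)

lemma signAvg_add (M N : (ι → Bool) → ℝ) :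
    signAvg (fun σ => M σ + N σ) = signAvg M + signAvg N := by
  simp [signAvg, sum_add_distrib, add_div]

lemma signAvg_const_mul (c : ℝ) (M : (ι → Bool) → ℝ) :
    signAvg (fun σ => c * M σ) = c * signAvg M := by
  simp [signAvg, ← mul_sum, mul_div_assoc]

lemma signAvg_const (c : ℝ) : signAvg (fun _ : ι → Bool => c) = c := by
  simp [signAvg]

lemma signAvg_sum {κ : Type*} (s : Finset κ) (M : κ → (ι → Bool) → ℝ) :
    signAvg (fun σ => ∑ a ∈ s, M a σ) = ∑ a ∈ s, signAvg (M a) := by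
  simp only [signAvg]
  rw [sum_comm, sum_div]

/-- The average factorizes into a product of `cosh (v i)`, and `cosh x ≤ exp (x² / 2)`: a sign sum
is subgaussian. -/
lemma signAvg_exp_le (v : ι → ℝ) :
    signAvg (fun σ => Real.exp (∑ i, sgn (σ i) * v i)) ≤ Real.exp ((∑ i, v i ^ 2) / 2) := by
  have h : ∑ σ : ι → Bool, Real.exp (∑ i, sgn (σ i) * v i) = ∏ i, (2 * Real.cosh (v i)) := by
    have h2 : ∀ i, 2 * Real.cosh (v i) = ∑ b : Bool, Real.exp (sgn b * v i) := by
      intro i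
      rw [Real.cosh_eq, Fintype.sum_bool]
      simp only [sgn]
      simp
      ring
    simp_rw [h2, Real.exp_sum]
    rw [Finset.prod_univ_sum, Fintype.piFinset_univ]
  rw [signAvg, h, prod_mul_distrib, prod_const, card_univ,
    mul_div_cancel_left₀ _ (by positivity), sum_div, Real.exp_sum]
  exact prod_le_prod (fun i _ => (Real.cosh_pos _).le) fun i _ => Real.cosh_le_exp_half_sq _

/-- Massart's finite class lemma, with the maximum replaced by an upper bound. -/
lemma exists_bound_signSum {κ : Type*} (s : Finset κ) (hs : s.Nonempty) (v : κ → ι → ℝ) {B l : ℝ}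
    (hl : 0 < l) (hB : ∀ a ∈ s, ∑ i, v a i ^ 2 ≤ B) :
    ∃ M : (ι → Bool) → ℝ, (∀ σ, ∀ a ∈ s, |∑ i, sgn (σ i) * v a i| ≤ M σ) ∧
      signAvg M ≤ Real.log (2 * #s) / l + l * B / 2 := by
  have hs' : (0 : ℝ) < #s := by exact_mod_cast hs.card_pos
  set z : ℝ := 2 * #s * Real.exp (l ^ 2 * B / 2) with hz
  have hz0 : 0 < z := by positivity
  have hlz : Real.log z = Real.log (2 * #s) + l ^ 2 * B / 2 := by
    rw [hz, Real.log_mul (by positivity) (by positivity), Real.log_exp]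
  let Z : (ι → Bool) → ℝ := fun σ => ∑ a ∈ s, (Real.exp (∑ i, sgn (σ i) * (l * v a i)) +
    Real.exp (∑ i, sgn (σ i) * (-l * v a i)))
  have hZ : signAvg Z ≤ z := by
    have h1 : ∀ a ∈ s, signAvg (fun σ => Real.exp (∑ i, sgn (σ i) * (l * v a i)) +
        Real.exp (∑ i, sgn (σ i) * (-l * v a i))) ≤ 2 * Real.exp (l ^ 2 * B / 2) := by
      intro a ha
      rw [signAvg_add, two_mul]
      have := hB a ha
      refine add_le_add ((signAvg_exp_le _).trans ?_) ((signAvg_exp_le _).trans ?_) <;>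
      · simp only [mul_pow, ← mul_sum, neg_sq]
        gcongr
    rw [signAvg_sum]
    refine (sum_le_sum h1).trans ?_
    rw [sum_const, nsmul_eq_mul, hz]
    exact le_of_eq (by ring)
  -- The tangent of `log` at `z` majorizes `log (Z σ)`. It is affine in `Z`, so it can be averaged
  -- directly, in place of Jensen's inequality.
  refine ⟨fun σ => (1 / l) * ((Real.log z - 1) + (1 / z) * Z σ), fun σ a ha => ?_, ?_⟩
  · have h0 : Real.exp (l * |∑ i, sgn (σ i) * v a i|) ≤ Z σ := by
      refine le_trans ?_ (single_le_sum (f := fun a => Real.exp (∑ i, sgn (σ i) * (l * v a i)) +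
        Real.exp (∑ i, sgn (σ i) * (-l * v a i))) (fun _ _ => by positivity) ha)
      have e1 : ∑ i, sgn (σ i) * (l * v a i) = l * ∑ i, sgn (σ i) * v a i := by
        rw [mul_sum]; exact sum_congr rfl fun i _ => by ring
      have e2 : ∑ i, sgn (σ i) * (-l * v a i) = l * -∑ i, sgn (σ i) * v a i := by
        rw [mul_neg, mul_sum, ← sum_neg_distrib]; exact sum_congr rfl fun i _ => by ring
      rw [e1, e2]
      rcases abs_cases (∑ i, sgn (σ i) * v a i) with ⟨h, -⟩ | ⟨h, -⟩ <;> rw [h]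
      · exact le_add_of_nonneg_right (Real.exp_pos _).le
      · exact le_add_of_nonneg_left (Real.exp_pos _).le
    have hZp : 0 < Z σ := (Real.exp_pos _).trans_le h0
    have h1 : l * |∑ i, sgn (σ i) * v a i| ≤ Real.log (Z σ) := by
      rw [← Real.log_exp (l * _)]
      exact Real.log_le_log (Real.exp_pos _) h0
    have h2 := Real.log_le_sub_one_of_pos (div_pos hZp hz0)
    rw [Real.log_div hZp.ne' hz0.ne'] at h2
    change _ ≤ 1 / l * (Real.log z - 1 + 1 / z * Z σ)
    rw [one_div, ← div_eq_inv_mul, le_div_iff₀ hl, one_div, ← div_eq_inv_mul]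
    linarith
  · rw [signAvg_const_mul, signAvg_add, signAvg_const, signAvg_const_mul]
    have h3 : 1 / z * signAvg Z ≤ 1 := by
      rw [one_div, ← div_eq_inv_mul]; exact (div_le_one hz0).2 hZ
    calc 1 / l * (Real.log z - 1 + 1 / z * signAvg Z) ≤ 1 / l * Real.log z := by
          gcongr; linarith
      _ = _ := by rw [hlz]; field_simp

end signAvg

/-- Since `x ^ V ≤ x ^ i` for `i ≤ V`, the sum times `x ^ V` is below the binomial expansion of `(1
+ x) ^ m`. The free `x` allows the exponential factor to be absorbed later. -/
lemma sum_choose_le_exp (m V : ℕ) {x : ℝ} (hx : 0 < x) (hx1 : x ≤ 1) :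
    (∑ i ∈ Iic V, (m.choose i : ℝ)) ≤ (1 / x) ^ V * Real.exp (x * m) := by
  have h1 : x ^ V * ∑ i ∈ Iic V, (m.choose i : ℝ) ≤ (1 + x) ^ m := by
    rw [add_comm, add_pow, mul_sum]
    calc ∑ i ∈ Iic V, x ^ V * (m.choose i : ℝ) ≤ ∑ i ∈ Iic V, x ^ i * (m.choose i : ℝ) := by
          refine sum_le_sum fun i hi => ?_
          exact mul_le_mul_of_nonneg_right (pow_le_pow_of_le_one hx.le hx1 (mem_Iic.1 hi))
            (Nat.cast_nonneg _)
      _ ≤ ∑ i ∈ range (m + 1) ∪ Iic V, x ^ i * (m.choose i : ℝ) :=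
          sum_le_sum_of_subset_of_nonneg subset_union_right fun _ _ _ => by positivity
      _ = ∑ i ∈ range (m + 1), x ^ i * (m.choose i : ℝ) := by
          refine (sum_subset subset_union_left fun i _ hi => ?_).symm
          rw [Nat.choose_eq_zero_of_lt (by simpa using hi)]; simp
      _ = _ := by simp
  have h2 : (1 + x) ^ m ≤ Real.exp (x * m) := by
    rw [mul_comm, Real.exp_nat_mul]
    gcongr
    linarith [Real.add_one_le_exp x]
  rw [one_div, inv_pow, ← div_eq_inv_mul, le_div_iff₀ (by positivity), mul_comm]
  exact h1.trans h2

/-- Two indices with the same value under `s` are never separated, so `s` is injective on a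
shattered set, whose image is then shattered by `T`. -/
lemma vcDim_image_preimage_le {α β : Type*} [DecidableEq α] [DecidableEq β] [Fintype β]
    (T : Finset (Finset α)) (s : β → α) :
    (T.image fun A => univ.filter fun t => s t ∈ A).vcDim ≤ T.vcDim := by
  refine Finset.sup_le fun U hU => ?_
  rw [mem_shatterer] at hU
  have hinj : Set.InjOn s U := by
    intro u hu v hv huv
    by_contra hne
    obtain ⟨W, hW, hWu⟩ := hU (t := {u}) (by simpa using hu)
    obtain ⟨A, hA, rfl⟩ := mem_image.1 hW
    have h1 : u ∈ ({u} : Finset β) := mem_singleton_self u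
    have h2 : v ∉ ({u} : Finset β) := by simpa using Ne.symm hne
    rw [← hWu] at h1 h2
    simp only [mem_inter, mem_filter, mem_univ, true_and] at h1 h2
    exact h2 ⟨hv, huv ▸ h1.2⟩
  have hsh : T.Shatters (U.image s) := by
    intro R hR
    obtain ⟨W, hW, hWu⟩ := hU (t := U.filter fun u => s u ∈ R) (filter_subset _ _)
    obtain ⟨A, hA, rfl⟩ := mem_image.1 hW
    refine ⟨A, hA, ?_⟩
    ext a
    simp only [mem_inter, mem_image]
    constructor
    · rintro ⟨⟨u, hu, rfl⟩, ha⟩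
      have : u ∈ U ∩ univ.filter fun t => s t ∈ A := by simp [hu, ha]
      rw [hWu] at this
      exact (mem_filter.1 this).2
    · intro ha
      obtain ⟨u, hu, rfl⟩ := mem_image.1 (hR ha)
      refine ⟨⟨u, hu, rfl⟩, ?_⟩
      have : u ∈ U.filter fun u => s u ∈ R := by simp [hu, ha]
      rw [← hWu] at this
      simpa using (mem_inter.1 this).2
  rw [← card_image_of_injOn hinj]
  exact hsh.card_le_vcDim

/-- If the members of a family pairwise differ in more than a `δ` fraction of the points, then its
cardinality is bounded in terms of `δ` and the VC dimension. -/
lemma log_card_le_of_separated {ι : Type*} [Fintype ι] [DecidableEq ι] (T : Finset (Finset ι))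
    (hT : T.Nonempty) {V : ℕ} (hV : T.vcDim ≤ V) {δ : ℝ} (hδ : 0 < δ) (hδ1 : δ ≤ 1)
    (hsep : ∀ A ∈ T, ∀ B ∈ T, A ≠ B → δ * Fintype.card ι < #(symmDiff A B)) :
    Real.log #T ≤ 2 * V * Real.log (4 / δ) + 1 := by
  have hT0 : (0 : ℝ) < #T := by exact_mod_cast hT.card_pos
  set L := Real.log #T with hL
  have hL0 : 0 ≤ L := Real.log_nonneg (by exact_mod_cast hT.card_pos)
  rcases isEmpty_or_nonempty ι with hι | hι
  · have : #T ≤ 1 := card_le_one.2 fun A _ B _ => Subsingleton.elim A B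
    have h1 : L ≤ 0 := Real.log_nonpos hT0.le (by exact_mod_cast this)
    have : 0 ≤ Real.log (4 / δ) := Real.log_nonneg (by rw [le_div_iff₀ hδ]; linarith)
    have : 0 ≤ 2 * V * Real.log (4 / δ) := by positivity
    linarith
  set n := Fintype.card ι with hn
  have hn0 : (0 : ℝ) < n := by exact_mod_cast Fintype.card_pos
  -- There are at most `exp (2 L)` pairs and a random sample misses a given difference with
  -- probability at most `exp (-δ m)`, so the union bound needs `δ m` just above `2 L`.
  set m : ℕ := ⌊2 * L / δ⌋₊ + 1 with hm
  have hm1 : 2 * L < δ * m := by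
    have := Nat.lt_floor_add_one (2 * L / δ)
    rw [div_lt_iff₀ hδ] at this
    rw [hm]; push_cast; linarith
  have hm2 : δ * m ≤ 2 * L + δ := by
    have := Nat.floor_le (a := 2 * L / δ) (by positivity)
    rw [le_div_iff₀ hδ] at this
    rw [hm]; push_cast; linarith
  -- some sample of size `m` separates all the members of the family
  obtain ⟨s, hs⟩ : ∃ s : Fin m → ι, ∀ A ∈ T, ∀ B ∈ T, A ≠ B → ∃ t, s t ∈ symmDiff A B := by
    by_contra hcon
    push Not at hcon
    let P := (T ×ˢ T).filter fun p => p.1 ≠ p.2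
    have hcov : (univ : Finset (Fin m → ι)) ⊆
        P.biUnion fun p => Fintype.piFinset fun _ : Fin m => (symmDiff p.1 p.2)ᶜ := by
      intro s _
      obtain ⟨A, hA, B, hB, hAB, h⟩ := hcon s
      refine mem_biUnion.2 ⟨(A, B), by simp [P, hA, hB, hAB], ?_⟩
      simp only [Fintype.mem_piFinset, mem_compl]
      exact h
    have h1 := (card_le_card hcov).trans card_biUnion_le
    have h2 : ∀ p ∈ P, ((#(Fintype.piFinset fun _ : Fin m => (symmDiff p.1 p.2)ᶜ) : ℕ) : ℝ) ≤
        n ^ m * Real.exp (-(δ * m)) := by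
      intro p hp
      simp only [P, mem_filter, mem_product] at hp
      have h3 := hsep _ hp.1.1 _ hp.1.2 hp.2
      have h4 : #(symmDiff p.1 p.2) + #(symmDiff p.1 p.2)ᶜ = n := card_add_card_compl _
      have h5 : (#(symmDiff p.1 p.2)ᶜ : ℝ) ≤ n * Real.exp (-δ) := by
        have : (#(symmDiff p.1 p.2) : ℝ) + #(symmDiff p.1 p.2)ᶜ = n := by exact_mod_cast h4
        have h6 := Real.add_one_le_exp (-δ)
        nlinarith
      rw [Fintype.card_piFinset, prod_const, card_univ, Fintype.card_fin]
      push_cast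
      calc (#(symmDiff p.1 p.2)ᶜ : ℝ) ^ m ≤ (n * Real.exp (-δ)) ^ m := by gcongr
        _ = _ := by rw [mul_pow, ← Real.exp_nat_mul]; ring_nf
    have h3 : (n : ℝ) ^ m ≤ #P * (n ^ m * Real.exp (-(δ * m))) := by
      calc (n : ℝ) ^ m = ((#(univ : Finset (Fin m → ι)) : ℕ) : ℝ) := by
            simp [hn]
        _ ≤ ∑ p ∈ P, ((#(Fintype.piFinset fun _ : Fin m => (symmDiff p.1 p.2)ᶜ) : ℕ) : ℝ) := by
            exact_mod_cast h1
        _ ≤ ∑ p ∈ P, (n ^ m * Real.exp (-(δ * m)) : ℝ) := sum_le_sum h2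
        _ = _ := by simp
    have h4 : (#P : ℝ) ≤ Real.exp (2 * L) := by
      have : #P ≤ #T * #T := (card_filter_le _ _).trans (card_product _ _).le
      rw [two_mul, Real.exp_add, hL, Real.exp_log hT0]
      exact_mod_cast this
    have h5 : (n : ℝ) ^ m ≤ n ^ m * Real.exp (2 * L - δ * m) := by
      refine h3.trans ?_
      rw [sub_eq_add_neg, Real.exp_add]
      calc _ ≤ Real.exp (2 * L) * (n ^ m * Real.exp (-(δ * m))) := by gcongr
        _ = _ := by ring
    have h6 : Real.exp (2 * L - δ * m) < 1 := by rw [← Real.exp_zero]; exact Real.exp_lt_exp.2 (by linarith)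
    have h7 : (0 : ℝ) < (n : ℝ) ^ m := by positivity
    nlinarith
  -- restricting to this sample is injective on the family
  let T' : Finset (Finset (Fin m)) := T.image fun A => univ.filter fun t => s t ∈ A
  have hcard : #T' = #T := by
    refine card_image_of_injOn fun A hA B hB hAB => ?_
    by_contra hne
    obtain ⟨t, ht⟩ := hs A hA B hB hne
    have : s t ∈ A ↔ s t ∈ B := by
      have := congrArg (t ∈ ·) hAB
      simpa using this
    rw [mem_symmDiff] at ht
    tauto
  have hle : #T ≤ ∑ i ∈ Iic V, m.choose i := by
    calc #T = #T' := hcard.symm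
      _ ≤ ∑ i ∈ Iic T'.vcDim, (Fintype.card (Fin m)).choose i :=
          (card_le_card_shatterer T').trans card_shatterer_le_sum_vcDim
      _ ≤ ∑ i ∈ Iic V, m.choose i := by
          rw [Fintype.card_fin]
          exact sum_le_sum_of_subset
            (Iic_subset_Iic.2 ((vcDim_image_preimage_le T s).trans hV))
  -- With `x = δ / 4` in the Sauer–Shelah bound the exponent is at most `L / 2 + 1 / 4`, and `L / 2`
  -- can be moved to the left.
  have hle' : (#T : ℝ) ≤ (4 / δ) ^ V * Real.exp (δ / 4 * m) := by
    have := sum_choose_le_exp m V (x := δ / 4) (by positivity) (by linarith)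
    rw [one_div_div] at this
    exact le_trans (by exact_mod_cast hle) this
  have h8 : L ≤ V * Real.log (4 / δ) + δ / 4 * m := by
    have := Real.log_le_log hT0 hle'
    rwa [Real.log_mul (by positivity) (by positivity), Real.log_pow, Real.log_exp] at this
  linarith

/-- Every finite family contains a `δ`-separated `δ`-net for the Hamming distance. -/
lemma exists_separated_net {ι : Type*} [Fintype ι] [DecidableEq ι] (T : Finset (Finset ι))
    (hT : T.Nonempty) (r : ℝ) :
    ∃ N ⊆ T, N.Nonempty ∧ (∀ A ∈ N, ∀ B ∈ N, A ≠ B → r < #(symmDiff A B)) ∧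
      ∀ A ∈ T, ∃ B ∈ N, (#(symmDiff A B) : ℝ) ≤ max r 0 := by
  classical
  let S := T.powerset.filter fun N => ∀ A ∈ N, ∀ B ∈ N, A ≠ B → r < #(symmDiff A B)
  obtain ⟨N, hN, hmax⟩ := exists_max_image S card ⟨∅, by simp [S]⟩
  simp only [S, mem_filter, mem_powerset] at hN hmax
  -- A separated subset of maximal cardinality is a net. The maximum with `0` covers negative `r`.
  have hcov : ∀ A ∈ T, ∃ B ∈ N, (#(symmDiff A B) : ℝ) ≤ max r 0 := by
    intro A hA
    by_contra! hcon
    have hAN : A ∉ N := fun h => by simpa using hcon A h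
    have := hmax (insert A N) ⟨insert_subset hA hN.1, ?_⟩
    · rw [card_insert_of_notMem hAN] at this
      omega
    · intro B hB C hC hBC
      rw [mem_insert] at hB hC
      rcases hB with rfl | hB <;> rcases hC with rfl | hC
      · exact absurd rfl hBC
      · exact (le_max_left _ _).trans_lt (hcon C hC)
      · rw [symmDiff_comm]; exact (le_max_left _ _).trans_lt (hcon B hB)
      · exact hN.2 B hB C hC hBC
  refine ⟨N, hN.1, ?_, hN.2, hcov⟩
  obtain ⟨A, hA⟩ := hT
  obtain ⟨B, hB, -⟩ := hcov A hA
  exact ⟨B, hB⟩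

lemma sum_sgn_sub_indicator_sq {ι : Type*} [Fintype ι] [DecidableEq ι] (A B : Finset ι) :
    ∑ i, ((if i ∈ A then (1 : ℝ) else 0) - if i ∈ B then 1 else 0) ^ 2 =
      (#(symmDiff A B) : ℝ) := by
  have h : ∀ i, ((if i ∈ A then (1 : ℝ) else 0) - if i ∈ B then 1 else 0) ^ 2 =
      if i ∈ symmDiff A B then 1 else 0 := by
    intro i
    by_cases h1 : i ∈ A <;> by_cases h2 : i ∈ B <;> simp [h1, h2, mem_symmDiff]
  simp [h]

/-- Dudley's chaining bound for the Rademacher averages of a family of bounded VC dimension. -/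
theorem exists_bound_signSum_of_vcDim {ι : Type*} [Fintype ι] [DecidableEq ι]
    (T : Finset (Finset ι)) {V : ℕ} (hV1 : 1 ≤ V) (hV : T.vcDim ≤ V) :
    ∃ M : (ι → Bool) → ℝ, (∀ σ, ∀ A ∈ T, |∑ i, sgn (σ i) * if i ∈ A then 1 else 0| ≤ M σ) ∧
      signAvg M ≤ 20 * Real.sqrt (V * Fintype.card ι) := by
  rcases T.eq_empty_or_nonempty with rfl | hT
  · exact ⟨fun _ => 0, by simp, by rw [signAvg_const]; positivity⟩
  rcases isEmpty_or_nonempty ι with hι | hι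
  · exact ⟨fun _ => 0, by simp, by rw [signAvg_const]; positivity⟩
  set n := Fintype.card ι with hn
  have hn0 : (0 : ℝ) < n := by exact_mod_cast Fintype.card_pos
  have hV0 : (1 : ℝ) ≤ V := by exact_mod_cast hV1
  have hVn : 0 < Real.sqrt (V * n) := Real.sqrt_pos.2 (by positivity)
  -- Hamming radius `4⁻ˡ n` is Euclidean radius `2⁻ˡ √n` for the indicator vectors.
  choose N hNT hN0 hNsep hNcov using fun l : ℕ => exists_separated_net T hT ((1 / 4) ^ l * n)
  have hmax : ∀ l : ℕ, max ((1 / 4 : ℝ) ^ l * n) 0 = (1 / 4) ^ l * n := fun l =>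
    max_eq_left (by positivity)
  simp only [hmax] at hNcov
  have hlog : ∀ l, Real.log (2 * #(N l)) ≤ V * (3 * l + 5) := by
    intro l
    have h1 := log_card_le_of_separated (N l) (hN0 l) ((vcDim_mono (hNT l)).trans hV)
      (δ := (1 / 4) ^ l) (by positivity) (pow_le_one₀ (by norm_num) (by norm_num)) (hNsep l)
    have h2 : Real.log (4 / (1 / 4) ^ l) = (l + 1) * (2 * Real.log 2) := by
      have : (4 : ℝ) / (1 / 4) ^ l = 2 ^ (2 * (l + 1)) := by
        rw [pow_mul, one_div, inv_pow, div_inv_eq_mul, pow_succ]; norm_num; ring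
      rw [this, Real.log_pow]; push_cast; ring
    have h3 := Real.log_two_lt_d9
    have h4 := Real.log_two_gt_d9
    have h5 : (0 : ℝ) < #(N l) := by exact_mod_cast (hN0 l).card_pos
    rw [Real.log_mul (by norm_num) h5.ne']
    rw [h2] at h1
    have h6 : (0 : ℝ) ≤ l := Nat.cast_nonneg l
    have h7 : 2 * (V : ℝ) * ((l + 1) * (2 * Real.log 2)) ≤ V * (3 * l + 3) := by
      have : (l + 1) * (4 * Real.log 2) ≤ 3 * l + 3 := by nlinarith
      nlinarith
    nlinarith
  have hcore : ∀ (S R : Finset (Finset ι)) (l : ℕ) (b : ℝ), S.Nonempty →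
      Real.log (2 * #S) ≤ V * (3 * l + 5) →
      (∀ A ∈ S, ∃ B ∈ R, (#(symmDiff A B) : ℝ) ≤ 4 * (1 / 4) ^ l * n) →
      (∃ M : (ι → Bool) → ℝ, (∀ σ, ∀ A ∈ R, |∑ i, sgn (σ i) * if i ∈ A then 1 else 0| ≤ M σ) ∧
        signAvg M ≤ Real.sqrt (V * n) * b) →
      ∃ M : (ι → Bool) → ℝ, (∀ σ, ∀ A ∈ S, |∑ i, sgn (σ i) * if i ∈ A then 1 else 0| ≤ M σ) ∧
        signAvg M ≤ Real.sqrt (V * n) * (b + (1 / 2) ^ l * (3 * l + 7)) := by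
    rintro S R l b hS hlogS hcov ⟨M, hM, hMavg⟩
    choose! p hpR hp using hcov
    -- This parameter balances the two terms of Massart's bound: entropy `V (3 l + 5)` costs `√(V n)
    -- 2⁻ˡ (3 l + 5)`, and squared increments `4 · 4⁻ˡ n` cost `√(V n) 2⁻ˡ · 2`.
    have hlam : 0 < 2 ^ l * Real.sqrt (V * n) / n := by positivity
    obtain ⟨M', hM', hMavg'⟩ := exists_bound_signSum S hS
      (fun A i => (if i ∈ A then (1 : ℝ) else 0) - if i ∈ p A then 1 else 0) hlam
      (B := 4 * (1 / 4) ^ l * n)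
      (fun A hA => by rw [sum_sgn_sub_indicator_sq]; exact hp A hA)
    refine ⟨fun σ => M σ + M' σ, fun σ A hA => ?_, ?_⟩
    · have h1 := hM σ (p A) (hpR A hA)
      have h2 := hM' σ A hA
      have h3 : ∑ i, sgn (σ i) * (if i ∈ A then (1 : ℝ) else 0) =
          ∑ i, sgn (σ i) * (if i ∈ p A then (1 : ℝ) else 0) +
          ∑ i, sgn (σ i) * ((if i ∈ A then (1 : ℝ) else 0) - if i ∈ p A then 1 else 0) := by
        rw [← sum_add_distrib]; exact sum_congr rfl fun i _ => by ring
      rw [h3]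
      exact (abs_add_le _ _).trans (add_le_add h1 h2)
    · rw [signAvg_add, mul_add]
      refine add_le_add hMavg (hMavg'.trans ?_)
      have hsq : Real.sqrt (V * n) ^ 2 = V * n := Real.sq_sqrt (by positivity)
      have e1 : Real.log (2 * #S) / (2 ^ l * Real.sqrt (V * n) / n) ≤
          Real.sqrt (V * n) * ((1 / 2) ^ l * (3 * l + 5)) := by
        rw [div_le_iff₀ hlam]
        refine hlogS.trans (le_of_eq ?_)
        have : ((1 : ℝ) / 2) ^ l * 2 ^ l = 1 := by rw [← mul_pow]; norm_num
        calc (V : ℝ) * (3 * l + 5) = (V * n) / n * (3 * l + 5) * ((1 / 2) ^ l * 2 ^ l) := by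
              rw [this]; field_simp
          _ = Real.sqrt (V * n) ^ 2 / n * (3 * l + 5) * ((1 / 2) ^ l * 2 ^ l) := by rw [hsq]
          _ = _ := by ring
      have e2 : 2 ^ l * Real.sqrt (V * n) / n * (4 * (1 / 4) ^ l * n) / 2 =
          Real.sqrt (V * n) * ((1 / 2) ^ l * 2) := by
        have : (2 : ℝ) ^ l * (1 / 4) ^ l = (1 / 2) ^ l := by rw [← mul_pow]; norm_num
        rw [← this]; field_simp; ring
      rw [e2]
      calc _ ≤ Real.sqrt (V * n) * ((1 / 2) ^ l * (3 * l + 5)) +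
            Real.sqrt (V * n) * ((1 / 2) ^ l * 2) := by gcongr
        _ = _ := by ring
  -- The series of the terms `2⁻ʲ (3 j + 7)` has sum `20`, and its tail beyond `l` is `2⁻ˡ (3 l +
  -- 13)`. The chain starts from the empty set.
  have hchain : ∀ l : ℕ, ∃ M : (ι → Bool) → ℝ,
      (∀ σ, ∀ A ∈ N l, |∑ i, sgn (σ i) * if i ∈ A then 1 else 0| ≤ M σ) ∧
      signAvg M ≤ Real.sqrt (V * n) * (20 - (1 / 2) ^ l * (3 * l + 13)) := by
    intro l
    induction l with
    | zero =>
      obtain ⟨M, hM, hMavg⟩ := hcore (N 0) {∅} 0 0 (hN0 0) (hlog 0)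
        (fun A _ => ⟨∅, by simp, by
          have : (#A : ℝ) ≤ n := by exact_mod_cast card_le_univ A
          simp [symmDiff]; linarith⟩)
        ⟨fun _ => 0, by simp, by rw [signAvg_const]; simp⟩
      exact ⟨M, hM, hMavg.trans (le_of_eq (by norm_num))⟩
    | succ l ih =>
      obtain ⟨M, hM, hMavg⟩ := hcore (N (l + 1)) (N l) (l + 1) _ (hN0 _) (hlog _)
        (fun A hA => by
          obtain ⟨B, hB, h⟩ := hNcov l A (hNT _ hA)
          exact ⟨B, hB, h.trans (le_of_eq (by rw [pow_succ]; ring))⟩) ih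
      refine ⟨M, hM, hMavg.trans (le_of_eq ?_)⟩
      rw [pow_succ]; push_cast; ring
  -- Once `4⁻ˡ n < 1`, integrality of the Hamming distance makes the net all of `T`.
  obtain ⟨l, hl⟩ := exists_pow_lt_of_lt_one (y := (1 / 4 : ℝ)) (one_div_pos.2 hn0) (by norm_num)
  obtain ⟨M, hM, hMavg⟩ := hchain l
  refine ⟨M, fun σ A hA => ?_, hMavg.trans ?_⟩
  · obtain ⟨B, hB, h⟩ := hNcov l A hA
    have h0 : (#(symmDiff A B) : ℝ) < 1 := by
      refine h.trans_lt ?_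
      rwa [lt_div_iff₀ hn0] at hl
    have h1 : #(symmDiff A B) = 0 := by
      have : #(symmDiff A B) < 1 := by exact_mod_cast h0
      omega
    rw [card_eq_zero] at h1
    rw [symmDiff_eq_bot.1 h1]
    exact hM σ B hB
  · rw [mul_comm]
    gcongr
    have : (0 : ℝ) ≤ (1 / 2) ^ l * (3 * l + 13) := by positivity
    linarith

end

/-! ### Symmetrization and uniform deviations. -/

section

open Finset

section symmetrization

variable {Y : Type*} [MeasurableSpace Y] {n : ℕ}

/-- Exchange the two entries of the `i`-th pair for all `i` with `σ i = false`. -/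
def swapPairs (σ : Fin n → Bool) (z : Fin n → Y × Y) : Fin n → Y × Y :=
  fun i => if σ i then z i else (z i).swap

lemma measurePreserving_swapPairs (μ : Measure Y) [IsProbabilityMeasure μ] (σ : Fin n → Bool) :
    MeasurePreserving (swapPairs σ) (Measure.pi fun _ : Fin n => μ.prod μ)
      (Measure.pi fun _ : Fin n => μ.prod μ) := by
  refine measurePreserving_pi (f := fun i (p : Y × Y) => if σ i then p else p.swap) _ _
    fun i => ?_
  by_cases h : σ i
  · simp only [h, if_true]; exact MeasurePreserving.id _
  · simpa [h] using Measure.measurePreserving_swap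

/-- Symmetrization: the expected uniform deviation is at most twice a bound for all the
Rademacher averages. -/
lemma integral_sup_deviation_le {κ : Type*} [Fintype κ] [Nonempty κ] (μ : Measure Y)
    [IsProbabilityMeasure μ] (f : κ → Y → ℝ) (hf : ∀ a, Measurable (f a))
    (hf0 : ∀ a y, 0 ≤ f a y) (hf1 : ∀ a y, f a y ≤ 1) {R : ℝ}
    (hR : ∀ x : Fin n → Y, ∃ M : (Fin n → Bool) → ℝ,
      (∀ σ a, |∑ i, sgn (σ i) * f a (x i)| ≤ M σ) ∧ signAvg M ≤ R) :
    ∫ x, univ.sup' univ_nonempty (fun a => |∑ i, f a (x i) - n * ∫ y, f a y ∂μ|)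
      ∂(Measure.pi fun _ : Fin n => μ) ≤ 2 * R := by
  set μn := Measure.pi fun _ : Fin n => μ
  let H : (Fin n → Y × Y) → ℝ := fun z =>
    univ.sup' univ_nonempty fun a => |∑ i, (f a (z i).1 - f a (z i).2)|
  let G : (Fin n → Y) × (Fin n → Y) → ℝ := fun p =>
    univ.sup' univ_nonempty fun a => |∑ i, (f a (p.1 i) - f a (p.2 i))|
  have hbd : ∀ (a : κ) (x x' : Fin n → Y), |∑ i, (f a (x i) - f a (x' i))| ≤ n := by
    intro a x x'
    refine (abs_sum_le_sum_abs _ _).trans ?_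
    calc ∑ i, |f a (x i) - f a (x' i)| ≤ ∑ _i : Fin n, (1 : ℝ) := by
          refine sum_le_sum fun i _ => abs_sub_le_iff.2 ⟨?_, ?_⟩ <;>
          linarith [hf0 a (x i), hf1 a (x i), hf0 a (x' i), hf1 a (x' i)]
      _ = n := by simp
  have hGm : Measurable G := by
    have : G = univ.sup' univ_nonempty fun a (p : (Fin n → Y) × (Fin n → Y)) =>
        |∑ i, (f a (p.1 i) - f a (p.2 i))| := by ext p; simp [G, Finset.sup'_apply]
    rw [this]
    exact measurable_sup' _ fun a _ => by have := hf a; fun_prop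
  have hG0 : ∀ p, ‖G p‖ ≤ n := by
    intro p
    have a := Classical.arbitrary κ
    rw [Real.norm_eq_abs, abs_le]
    refine ⟨?_, sup'_le _ _ fun a _ => hbd a _ _⟩
    refine le_trans (by linarith [(Nat.cast_nonneg n : (0 : ℝ) ≤ n)])
      ((abs_nonneg _).trans (le_sup' (fun a => |∑ i, (f a (p.1 i) - f a (p.2 i))|) (mem_univ a)))
  have hGint : Integrable G (μn.prod μn) :=
    Integrable.of_bound hGm.aestronglyMeasurable n (Filter.Eventually.of_forall hG0)
  have heval : ∀ (a : κ) (i : Fin n), ∫ x : Fin n → Y, f a (x i) ∂μn = ∫ y, f a y ∂μ := by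
    intro a i
    have h := measurePreserving_eval (fun _ : Fin n => μ) i
    rw [← h.map_eq, integral_map h.measurable.aemeasurable (hf a).aestronglyMeasurable]
  have hfint : ∀ (a : κ) (i : Fin n), Integrable (fun x : Fin n → Y => f a (x i)) μn := by
    intro a i
    refine Integrable.of_bound
      ((hf a).comp (measurable_pi_apply i)).aestronglyMeasurable 1
      (Filter.Eventually.of_forall fun x => ?_)
    rw [Real.norm_eq_abs, abs_of_nonneg (hf0 _ _)]; exact hf1 _ _
  have hmp := (measurePreserving_arrowProdEquivProdArrow Y Y (Fin n) (fun _ => μ) (fun _ => μ))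
  have hHm : Measurable H := by
    have : H = univ.sup' univ_nonempty fun a (z : Fin n → Y × Y) =>
        |∑ i, (f a (z i).1 - f a (z i).2)| := by ext p; simp [H, Finset.sup'_apply]
    rw [this]
    exact measurable_sup' _ fun a _ => by have := hf a; fun_prop
  have hH0 : ∀ z, ‖H z‖ ≤ n := fun z => hG0 (fun i => (z i).1, fun i => (z i).2)
  -- The mean is written as an integral over an independent ghost sample, and absolute value and
  -- maximum are taken inside it.
  have hstep1 : ∫ x, univ.sup' univ_nonempty (fun a => |∑ i, f a (x i) - n * ∫ y, f a y ∂μ|) ∂μn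
      ≤ ∫ x, ∫ x', G (x, x') ∂μn ∂μn := by
    have hle : ∀ x : Fin n → Y,
        univ.sup' univ_nonempty (fun a => |∑ i, f a (x i) - n * ∫ y, f a y ∂μ|) ≤
          ∫ x', G (x, x') ∂μn := by
      intro x
      refine sup'_le _ _ fun a _ => ?_
      have h1 : ∑ i, f a (x i) - n * ∫ y, f a y ∂μ =
          ∫ x' : Fin n → Y, ∑ i, (f a (x i) - f a (x' i)) ∂μn := by
        have h2 : ∀ i : Fin n, Integrable (fun x' : Fin n → Y => f a (x i) - f a (x' i)) μn :=
          fun i => (integrable_const _).sub (hfint a i)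
        rw [integral_finsetSum _ fun i _ => h2 i]
        simp_rw [integral_sub (integrable_const _) (hfint a _), heval, sum_sub_distrib]
        simp [μn]
      rw [h1]
      refine abs_integral_le_integral_abs.trans (integral_mono ?_ ?_ fun x' => ?_)
      · exact (integrable_finsetSum _ fun i _ => (integrable_const _).sub (hfint a i)).abs
      · exact Integrable.of_bound (hGm.comp measurable_prodMk_left).aestronglyMeasurable n
          (Filter.Eventually.of_forall fun x' => hG0 _)
      · exact le_sup' (fun a => |∑ i, (f a (x i) - f a (x' i))|) (mem_univ a)
    refine integral_mono_of_nonneg (Filter.Eventually.of_forall fun x => ?_)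
      hGint.integral_prod_left (Filter.Eventually.of_forall hle)
    obtain ⟨a⟩ := ‹Nonempty κ›
    exact (abs_nonneg _).trans
      (le_sup' (fun a => |∑ i, f a (x i) - n * ∫ y, f a y ∂μ|) (mem_univ a))
  have hstep2 : ∫ x, ∫ x', G (x, x') ∂μn ∂μn =
      ∫ z, H z ∂(Measure.pi fun _ : Fin n => μ.prod μ) := by
    rw [← integral_prod _ hGint, ← hmp.map_eq,
      integral_map hmp.measurable.aemeasurable hGm.aestronglyMeasurable]
    rfl
  -- Exchanging a point with its ghost preserves the law and flips the sign of its summand;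
  -- averaging over `σ` produces Rademacher sums.
  have hstep3 : ∀ σ : Fin n → Bool, ∫ z, H z ∂(Measure.pi fun _ : Fin n => μ.prod μ) =
      ∫ z, H (swapPairs σ z) ∂(Measure.pi fun _ : Fin n => μ.prod μ) := by
    intro σ
    have h := measurePreserving_swapPairs μ σ
    conv_lhs => rw [← h.map_eq]
    rw [integral_map h.measurable.aemeasurable hHm.aestronglyMeasurable]
  have hswap : ∀ (σ : Fin n → Bool) (z : Fin n → Y × Y), H (swapPairs σ z) =
      univ.sup' univ_nonempty fun a => |∑ i, sgn (σ i) * (f a (z i).1 - f a (z i).2)| := by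
    intro σ z
    simp only [H]
    congr 1
    funext a
    congr 1
    refine sum_congr rfl fun i _ => ?_
    by_cases h : σ i <;> simp [swapPairs, h, sgn]
  have hint : ∀ σ : Fin n → Bool, Integrable (fun z => H (swapPairs σ z))
      (Measure.pi fun _ : Fin n => μ.prod μ) := fun σ =>
    Integrable.of_bound
      (hHm.comp (measurePreserving_swapPairs μ σ).measurable).aestronglyMeasurable n
      (Filter.Eventually.of_forall fun z => hH0 _)
  have hstep4 : ∫ z, H z ∂(Measure.pi fun _ : Fin n => μ.prod μ) =
      ∫ z, signAvg (fun σ => H (swapPairs σ z)) ∂(Measure.pi fun _ : Fin n => μ.prod μ) := by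
    simp only [signAvg]
    rw [integral_div, integral_finsetSum _ fun σ _ => hint σ]
    simp_rw [← hstep3]
    simp
  rw [hstep2, hstep4] at hstep1
  refine hstep1.trans ?_
  have hpt : ∀ z : Fin n → Y × Y, signAvg (fun σ => H (swapPairs σ z)) ≤ 2 * R := by
    intro z
    obtain ⟨M, hM, hMR⟩ := hR fun i => (z i).1
    obtain ⟨M', hM', hMR'⟩ := hR fun i => (z i).2
    calc signAvg (fun σ => H (swapPairs σ z)) ≤ signAvg (fun σ => M σ + M' σ) := by
          refine signAvg_mono fun σ => ?_
          rw [hswap]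
          refine sup'_le _ _ fun a _ => ?_
          simp only [mul_sub, sum_sub_distrib]
          exact (abs_sub _ _).trans (add_le_add (hM σ a) (hM' σ a))
      _ ≤ 2 * R := by rw [signAvg_add]; linarith
  calc _ ≤ ∫ _z, 2 * R ∂(Measure.pi fun _ : Fin n => μ.prod μ) := by
        refine integral_mono ?_ (integrable_const _) hpt
        simp only [signAvg]
        exact (integrable_finsetSum _ fun σ _ => hint σ).div_const _
    _ = 2 * R := by simp

end symmetrization

/-- A sequence of sets has VC dimension at most `V`: so does the trace of every finite subfamily
on every finite sequence of points. -/
def VCBounded {Y κ : Type*} (A : κ → Set Y) (V : ℕ) : Prop :=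
  open Classical in
  ∀ (n : ℕ) (y : Fin n → Y) (s : Finset κ),
    (s.image fun a => univ.filter fun i => y i ∈ A a).vcDim ≤ V

/-- The empirical measure of a set. -/
def empirical {Y ι : Type*} [Fintype ι] (S : ι → Y) (B : Set Y) : ℝ :=
  (∑ i, B.indicator (fun _ => (1 : ℝ)) (S i)) / Fintype.card ι

lemma measurable_empirical {Y ι : Type*} [MeasurableSpace Y] [Fintype ι] {B : Set Y}
    (hB : MeasurableSet B) : Measurable fun S : ι → Y => empirical S B := by
  unfold empirical
  refine Measurable.div_const (measurable_sum _ fun i _ => ?_) _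
  exact (measurable_const.indicator hB).comp (measurable_pi_apply i)

/-- Symmetrization and chaining bound the expected unnormalized deviation by `40 √(V n)`. The
hypothesis on `n` gives `80 √(V n) ≤ t n`, so Markov's inequality yields `1 / 2`. This weak
confidence suffices because independent blocks amplify it later. -/
lemma VCBounded.deviation_finite {Y κ : Type*} [MeasurableSpace Y] {n V : ℕ} [Finite κ]
    (μ : Measure Y) [IsProbabilityMeasure μ] {A : κ → Set Y} (hA : ∀ a, MeasurableSet (A a))
    (hVC : VCBounded A V) (hV : 1 ≤ V) {t : ℝ} (ht : 0 < t) (hn : 6400 * V ≤ t ^ 2 * n) :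
    Measure.pi (fun _ : Fin n => μ) {S | ∃ a, t < |empirical S (A a) - μ.real (A a)|} ≤ 1 / 2 := by
  classical
  have := Fintype.ofFinite κ
  rcases isEmpty_or_nonempty κ with hκ | hκ
  · simp
  have hn0 : (0 : ℝ) < n := by
    have : (1 : ℝ) ≤ V := by exact_mod_cast hV
    by_contra h
    nlinarith [sq_nonneg t]
  let f : κ → Y → ℝ := fun a => (A a).indicator fun _ => 1
  have hf : ∀ a, Measurable (f a) := fun a => measurable_const.indicator (hA a)
  have hf0 : ∀ a y, 0 ≤ f a y := fun a y => Set.indicator_nonneg (fun _ _ => zero_le_one) y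
  have hf1 : ∀ a y, f a y ≤ 1 := fun a y => Set.indicator_le_self' (fun _ _ => zero_le_one) y
  have hfi : ∀ a, ∫ y, f a y ∂μ = μ.real (A a) := fun a => by
    simp only [f]; rw [integral_indicator (hA a)]; simp
  have hmain := integral_sup_deviation_le (n := n) μ f hf hf0 hf1
    (R := 20 * Real.sqrt (V * n)) (fun x => by
      obtain ⟨M, hM, hMR⟩ := exists_bound_signSum_of_vcDim
        ((univ : Finset κ).image fun a => univ.filter fun i => x i ∈ A a) hV
        (by convert hVC n x univ)
      refine ⟨M, fun σ a => ?_, by simpa using hMR⟩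
      have := hM σ _ (mem_image_of_mem _ (mem_univ a))
      simpa [f, Set.indicator_apply] using this)
  simp_rw [hfi] at hmain
  set F : (Fin n → Y) → ℝ := fun x =>
    univ.sup' univ_nonempty (fun a => |∑ i, f a (x i) - n * μ.real (A a)|) with hF
  have hF0 : ∀ x, 0 ≤ F x := fun x => by
    obtain ⟨a⟩ := hκ
    exact (abs_nonneg _).trans
      (le_sup' (fun a => |∑ i, f a (x i) - n * μ.real (A a)|) (mem_univ a))
  have hFm : Measurable F := by
    have : F = univ.sup' univ_nonempty fun a (x : Fin n → Y) =>
        |∑ i, f a (x i) - n * μ.real (A a)| := by ext p; simp [F, Finset.sup'_apply]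
    rw [this]
    exact measurable_sup' _ fun a _ => by have := hf a; fun_prop
  have hFb : ∀ x, ‖F x‖ ≤ n := fun x => by
    rw [Real.norm_eq_abs, abs_of_nonneg (hF0 x)]
    refine sup'_le _ _ fun a _ => ?_
    have h1 : ∑ i, f a (x i) ≤ n := by
      calc _ ≤ ∑ _i : Fin n, (1 : ℝ) := sum_le_sum fun i _ => hf1 _ _
        _ = n := by simp
    have h2 : 0 ≤ ∑ i, f a (x i) := sum_nonneg fun i _ => hf0 _ _
    have h3 : μ.real (A a) ≤ 1 := measureReal_le_one
    have h4 : 0 ≤ μ.real (A a) := measureReal_nonneg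
    rw [abs_le]; constructor <;> nlinarith
  have hmarkov := mul_meas_ge_le_integral_of_nonneg (μ := Measure.pi fun _ : Fin n => μ)
    (Filter.Eventually.of_forall hF0)
    (Integrable.of_bound hFm.aestronglyMeasurable n (Filter.Eventually.of_forall hFb)) (t * n)
  have hsub : {S : Fin n → Y | ∃ a, t < |empirical S (A a) - μ.real (A a)|} ⊆
      {x | t * n ≤ F x} := by
    rintro S ⟨a, ha⟩
    refine le_trans ?_ (le_sup' (fun a => |∑ i, f a (S i) - n * μ.real (A a)|) (mem_univ a))
    have : ∑ i, f a (S i) - n * μ.real (A a) = n * (empirical S (A a) - μ.real (A a)) := by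
      simp only [empirical, Fintype.card_fin, f]; field_simp
    rw [this, abs_mul, abs_of_pos hn0, mul_comm]
    gcongr
  have hreal : (Measure.pi fun _ : Fin n => μ).real {x | t * n ≤ F x} ≤ 1 / 2 := by
    have h1 := hmarkov.trans hmain
    have h2 : 80 * Real.sqrt (V * n) ≤ t * n := by
      rw [← Real.sqrt_sq (by positivity : 0 ≤ t * n),
        show (80 : ℝ) = Real.sqrt (80 ^ 2) by rw [Real.sqrt_sq (by norm_num)],
        ← Real.sqrt_mul (by norm_num)]
      apply Real.sqrt_le_sqrt
      nlinarith
    have h3 : 0 < t * n := by positivity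
    have h4 : (Measure.pi fun _ : Fin n => μ).real {x | t * n ≤ F x} * (t * n) ≤
        1 / 2 * (t * n) := by linarith
    exact le_of_mul_le_mul_right h4 h3
  refine (measure_mono hsub).trans ?_
  rw [← ENNReal.ofReal_toReal (measure_ne_top _ {x | t * n ≤ F x})]
  refine (ENNReal.ofReal_le_ofReal hreal).trans (le_of_eq ?_)
  rw [ENNReal.ofReal_div_of_pos (by norm_num)]; simp

/-- Uniform deviation inequality for a sequence of sets of bounded VC dimension. -/
theorem VCBounded.deviation {Y : Type*} [MeasurableSpace Y] {n V : ℕ}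
    (μ : Measure Y) [IsProbabilityMeasure μ] {A : ℕ → Set Y} (hA : ∀ a, MeasurableSet (A a))
    (hVC : VCBounded A V) (hV : 1 ≤ V) {t : ℝ} (ht : 0 < t) (hn : 6400 * V ≤ t ^ 2 * n) :
    Measure.pi (fun _ : Fin n => μ) {S | ∃ a, t < |empirical S (A a) - μ.real (A a)|} ≤ 1 / 2 := by
  classical
  -- The finite bound does not depend on the number of sets, so continuity from below extends it to
  -- the sequence.
  have hU : {S : Fin n → Y | ∃ a, t < |empirical S (A a) - μ.real (A a)|} =
      ⋃ N : ℕ, {S | ∃ a : Fin N, t < |empirical S (A a) - μ.real (A a)|} := by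
    ext S
    simp only [Set.mem_ofPred_eq, Set.mem_iUnion]
    exact ⟨fun ⟨a, ha⟩ => ⟨a + 1, ⟨a, a.lt_succ_self⟩, ha⟩, fun ⟨N, a, ha⟩ => ⟨a, ha⟩⟩
  have hmono : Monotone fun N : ℕ =>
      {S : Fin n → Y | ∃ a : Fin N, t < |empirical S (A a) - μ.real (A a)|} := by
    rintro N N' h S ⟨a, ha⟩
    exact ⟨Fin.castLE h a, ha⟩
  rw [hU, hmono.measure_iUnion]
  refine iSup_le fun N => VCBounded.deviation_finite (κ := Fin N) μ (fun a => hA a) ?_ hV ht hn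
  intro m y s
  refine le_trans (le_of_eq ?_) (hVC m y (s.map Fin.valEmbedding))
  congr 1
  ext U
  simp

end

/-! ### Total variation: Hahn sets and data processing. -/

section tvDist

variable {X Z : Type*} [MeasurableSpace X] [MeasurableSpace Z]

lemma abs_real_sub_le_one (p q : ProbabilityMeasure X) (B : Set X) :
    |(p : Measure X).real B - (q : Measure X).real B| ≤ 1 := by
  have h1 : (p : Measure X).real B ≤ 1 := measureReal_le_one
  have h2 : (q : Measure X).real B ≤ 1 := measureReal_le_one
  have h3 : 0 ≤ (p : Measure X).real B := measureReal_nonneg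
  have h4 : 0 ≤ (q : Measure X).real B := measureReal_nonneg
  rw [abs_le]; constructor <;> linarith

lemma abs_sub_le_tvDist (p q : ProbabilityMeasure X) {B : Set X} (hB : MeasurableSet B) :
    |(p : Measure X).real B - (q : Measure X).real B| ≤ tvDist p q :=
  le_ciSup (f := fun B : {B : Set X // MeasurableSet B} =>
    |(p : Measure X).real B.1 - (q : Measure X).real B.1|)
    ⟨1, by rintro _ ⟨B, rfl⟩; exact abs_real_sub_le_one p q _⟩ ⟨B, hB⟩

lemma tvDist_le {p q : ProbabilityMeasure X} {c : ℝ}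
    (h : ∀ B, MeasurableSet B → |(p : Measure X).real B - (q : Measure X).real B| ≤ c) :
    tvDist p q ≤ c :=
  haveI : Nonempty {B : Set X // MeasurableSet B} := ⟨⟨∅, MeasurableSet.empty⟩⟩
  ciSup_le fun B => h B.1 B.2

lemma tvDist_le_one (p q : ProbabilityMeasure X) : tvDist p q ≤ 1 :=
  tvDist_le fun B _ => abs_real_sub_le_one p q B

lemma tvDist_nonneg (p q : ProbabilityMeasure X) : 0 ≤ tvDist p q :=
  (abs_nonneg _).trans (abs_sub_le_tvDist p q MeasurableSet.empty)

lemma tvDist_comm (p q : ProbabilityMeasure X) : tvDist p q = tvDist q p := by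
  simp only [tvDist, abs_sub_comm]

lemma tvDist_triangle (p q r : ProbabilityMeasure X) :
    tvDist p r ≤ tvDist p q + tvDist q r :=
  tvDist_le fun _ hB => (abs_sub_le _ _ _).trans
    (add_le_add (abs_sub_le_tvDist p q hB) (abs_sub_le_tvDist q r hB))

lemma tvDist_map_le (p q : ProbabilityMeasure X) {f : X → Z} (hf : Measurable f) :
    tvDist (p.map hf.aemeasurable) (q.map hf.aemeasurable) ≤ tvDist p q := by
  refine tvDist_le fun B hB => ?_
  simp only [ProbabilityMeasure.toMeasure_map, map_measureReal_apply hf hB]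
  exact abs_sub_le_tvDist p q (hf hB)

/-- The total variation distance is attained on any Hahn set. -/
lemma tvDist_le_of_hahn {p q : ProbabilityMeasure X} {s : Set X} (hs : MeasurableSet s)
    (h1 : ∀ t, MeasurableSet t → t ⊆ s → (q : Measure X) t ≤ (p : Measure X) t)
    (h2 : ∀ t, MeasurableSet t → t ⊆ sᶜ → (p : Measure X) t ≤ (q : Measure X) t) :
    tvDist p q ≤ |(p : Measure X).real s - (q : Measure X).real s| := by
  have h1' : ∀ t, MeasurableSet t → t ⊆ s → (q : Measure X).real t ≤ (p : Measure X).real t :=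
    fun t ht hts => ENNReal.toReal_mono (measure_ne_top _ _) (h1 t ht hts)
  have h2' : ∀ t, MeasurableSet t → t ⊆ sᶜ → (p : Measure X).real t ≤ (q : Measure X).real t :=
    fun t ht hts => ENNReal.toReal_mono (measure_ne_top _ _) (h2 t ht hts)
  refine tvDist_le fun B hB => le_trans ?_ (le_abs_self _)
  have e1 := measureReal_inter_add_sdiff (μ := (p : Measure X)) (s := B) hs
  have e2 := measureReal_inter_add_sdiff (μ := (q : Measure X)) (s := B) hs
  have e3 := measureReal_inter_add_sdiff (μ := (p : Measure X)) (s := s) hB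
  have e4 := measureReal_inter_add_sdiff (μ := (q : Measure X)) (s := s) hB
  have e5 := measureReal_add_measureReal_compl (μ := (p : Measure X)) hs
  have e6 := measureReal_add_measureReal_compl (μ := (q : Measure X)) hs
  have e7 := measureReal_inter_add_sdiff (μ := (p : Measure X)) (s := sᶜ) hB
  have e8 := measureReal_inter_add_sdiff (μ := (q : Measure X)) (s := sᶜ) hB
  rw [Set.inter_comm s B] at e3 e4
  have e9 : sᶜ ∩ B = B \ s := by ext x; simp [and_comm]
  rw [e9] at e7 e8
  simp only [probReal_univ] at e5 e6
  have i1 := h1' _ (hB.inter hs) Set.inter_subset_right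
  have i2 := h1' _ (hs.diff hB) Set.sdiff_subset
  have i3 := h2' _ (hB.diff hs) (fun x hx => hx.2)
  have i4 := h2' _ (hs.compl.diff hB) Set.sdiff_subset
  rw [abs_le]; constructor <;> linarith

lemma exists_tvDist_le (p q : ProbabilityMeasure X) :
    ∃ s, MeasurableSet s ∧ tvDist p q ≤ |(p : Measure X).real s - (q : Measure X).real s| := by
  obtain ⟨s, hs, h1, h2⟩ := hahn_decomposition (p : Measure X) (q : Measure X)
  exact ⟨s, hs, tvDist_le_of_hahn hs h1 h2⟩

/-- On a Hahn set `s` the function `1 - h` is compared, and off `s` the function `h`; together the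
difference is at most `p s - q s`. -/
lemma integral_sub_le_tvDist (p q : ProbabilityMeasure X) {h : X → ℝ} (hm : Measurable h)
    (h0 : ∀ x, 0 ≤ h x) (h1 : ∀ x, h x ≤ 1) :
    ∫ x, h x ∂(p : Measure X) - ∫ x, h x ∂(q : Measure X) ≤ tvDist p q := by
  obtain ⟨s, hs, hs1, hs2⟩ := hahn_decomposition (p : Measure X) (q : Measure X)
  have hr1 : (q : Measure X).restrict s ≤ (p : Measure X).restrict s :=
    Measure.le_iff.2 fun t ht => by
      rw [Measure.restrict_apply ht, Measure.restrict_apply ht]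
      exact hs1 _ (ht.inter hs) Set.inter_subset_right
  have hr2 : (p : Measure X).restrict sᶜ ≤ (q : Measure X).restrict sᶜ :=
    Measure.le_iff.2 fun t ht => by
      rw [Measure.restrict_apply ht, Measure.restrict_apply ht]
      exact hs2 _ (ht.inter hs.compl) Set.inter_subset_right
  have hint : ∀ μ : Measure X, IsFiniteMeasure μ → Integrable h μ := fun μ _ =>
    Integrable.of_bound hm.aestronglyMeasurable 1 (Filter.Eventually.of_forall fun x => by
      rw [Real.norm_eq_abs, abs_of_nonneg (h0 x)]; exact h1 x)
  have e1 := integral_add_compl hs (hint (p : Measure X) inferInstance)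
  have e2 := integral_add_compl hs (hint (q : Measure X) inferInstance)
  have i1 := integral_mono_measure hr2 (Filter.Eventually.of_forall h0) (hint _ inferInstance)
  have i2 := integral_mono_measure hr1 (f := fun x => 1 - h x)
    (Filter.Eventually.of_forall fun x => sub_nonneg.2 (h1 x))
    ((integrable_const _).sub (hint _ inferInstance))
  rw [integral_sub (integrable_const _) (hint _ inferInstance),
    integral_sub (integrable_const _) (hint _ inferInstance)] at i2
  simp only [integral_const, measureReal_restrict_apply_univ, smul_eq_mul, mul_one] at i2
  have := (le_abs_self _).trans (abs_sub_le_tvDist p q hs)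
  linarith

/-- The composition of a distribution with a Markov kernel. -/
def compKernel (p : ProbabilityMeasure X) (κ : Kernel X Z) [IsMarkovKernel κ] :
    ProbabilityMeasure (X × Z) := ⟨(p : Measure X) ⊗ₘ κ, inferInstance⟩

/-- The mass of a set is the integral of the `[0, 1]`-valued kernel measure of its sections. This
carries closeness of unlabelled laws over to labelled ones. -/
lemma tvDist_compKernel_le (p q : ProbabilityMeasure X) (κ : Kernel X Z) [IsMarkovKernel κ] :
    tvDist (compKernel p κ) (compKernel q κ) ≤ tvDist p q := by
  have key : ∀ (r : ProbabilityMeasure X) {B : Set (X × Z)}, MeasurableSet B →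
      (compKernel r κ : Measure (X × Z)).real B =
        ∫ x, (κ x).real (Prod.mk x ⁻¹' B) ∂(r : Measure X) := by
    intro r B hB
    have hm := Kernel.measurable_kernel_prodMk_left (κ := κ) hB
    simp only [compKernel, ProbabilityMeasure.coe_mk, Measure.real]
    rw [Measure.compProd_apply hB, integral_toReal hm.aemeasurable
      (Filter.Eventually.of_forall fun x => measure_lt_top _ _)]
  refine tvDist_le fun B hB => ?_
  rw [key p hB, key q hB]
  have hm : Measurable fun x => (κ x).real (Prod.mk x ⁻¹' B) :=
    (Kernel.measurable_kernel_prodMk_left (κ := κ) hB).ennreal_toReal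
  rw [abs_le]
  have h1 := integral_sub_le_tvDist p q hm (fun _ => measureReal_nonneg) fun _ => measureReal_le_one
  have h2 := integral_sub_le_tvDist q p hm (fun _ => measureReal_nonneg) fun _ => measureReal_le_one
  rw [tvDist_comm] at h2
  constructor <;> linarith

/-- The set `{f' < f}` is a Hahn set; this gives the Yatracos sets an explicit form whose VC
dimension can be bounded. -/
lemma tvDist_withDensity_le {ν : Measure X} {p q : ProbabilityMeasure X} {f f' : X → ℝ}
    (hf : Measurable f) (hf' : Measurable f')
    (hp : (p : Measure X) = ν.withDensity fun x => ENNReal.ofReal (f x))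
    (hq : (q : Measure X) = ν.withDensity fun x => ENNReal.ofReal (f' x)) :
    tvDist p q ≤
      |(p : Measure X).real {x | f' x < f x} - (q : Measure X).real {x | f' x < f x}| := by
  refine tvDist_le_of_hahn (measurableSet_lt hf' hf) (fun t ht hts => ?_) fun t ht hts => ?_ <;>
  · rw [hp, hq, withDensity_apply _ ht, withDensity_apply _ ht]
    refine setLIntegral_mono' ht fun x hx => ENNReal.ofReal_le_ofReal ?_
    have := hts hx
    simp only [Set.mem_ofPred_eq, Set.mem_compl_iff, not_lt] at this
    linarith

end tvDist

/-! ### Minimum distance estimates. -/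

section minimumDistance

variable {Y : Type*} [MeasurableSpace Y]

/-- An infimum over infinitely many candidates may not be attained, hence the slack `η`; taking the
first near-minimizer of an enumeration gives measurability. -/
lemma exists_measurable_argmin {Ω C : Type*} [MeasurableSpace Ω] [MeasurableSpace C] [Countable C]
    [Nonempty C] (D : C → Ω → ℝ) (hD : ∀ c, Measurable (D c)) (hD0 : ∀ c ω, 0 ≤ D c ω) {η : ℝ}
    (hη : 0 < η) : ∃ sel : Ω → C, Measurable sel ∧ ∀ ω c, D (sel ω) ω ≤ D c ω + η := by
  classical
  obtain ⟨e, he⟩ := exists_surjective_nat C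
  have hex : ∀ ω, ∃ n : ℕ, ∀ m : ℕ, D (e n) ω ≤ D (e m) ω + η := by
    intro ω
    obtain ⟨n, hn⟩ := exists_lt_of_ciInf_lt (f := fun n => D (e n) ω)
      (lt_add_of_pos_right (⨅ n, D (e n) ω) hη)
    refine ⟨n, fun m => hn.le.trans ?_⟩
    have : ⨅ n, D (e n) ω ≤ D (e m) ω := ciInf_le ⟨0, by rintro _ ⟨n, rfl⟩; exact hD0 _ _⟩ m
    linarith
  refine ⟨fun ω => e (Nat.find (hex ω)), measurable_from_nat.comp (measurable_find hex fun n => ?_),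
    fun ω c => ?_⟩
  · rw [Set.ofPred_forall]
    exact MeasurableSet.iInter fun m => measurableSet_le (hD _) ((hD _).add_const _)
  · obtain ⟨m, rfl⟩ := he c
    exact Nat.find_spec (hex ω) m

/-- The minimum distance estimate over a countable class of distributions. -/
lemma exists_minimumDistance {C κ ι : Type*} [MeasurableSpace C] [Countable C] [Nonempty C]
    [Countable κ] [Nonempty κ] [Fintype ι] (p : C → ProbabilityMeasure Y) (A : κ → Set Y)
    (hA : ∀ a, MeasurableSet (A a))
    (hp : ∀ i j, ∃ a, tvDist (p i) (p j) ≤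
      |(p i : Measure Y).real (A a) - (p j : Measure Y).real (A a)|) {η : ℝ} (hη : 0 < η) :
    ∃ sel : (ι → Y) → C, Measurable sel ∧ ∀ (P : ProbabilityMeasure Y) (S : ι → Y) (t : ℝ),
      (∀ a, |empirical S (A a) - (P : Measure Y).real (A a)| ≤ t) →
      ∀ i, tvDist (p (sel S)) P ≤ 3 * tvDist (p i) P + 2 * t + η := by
  have hemp0 : ∀ (S : ι → Y) B, 0 ≤ empirical S B := fun S B =>
    div_nonneg (Finset.sum_nonneg fun i _ => Set.indicator_nonneg (fun _ _ => zero_le_one) _)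
      (Nat.cast_nonneg _)
  have hemp1 : ∀ (S : ι → Y) B, empirical S B ≤ 1 := fun S B => by
    refine div_le_one_of_le₀ ?_ (Nat.cast_nonneg _)
    calc _ ≤ ∑ _i : ι, (1 : ℝ) :=
          Finset.sum_le_sum fun i _ => Set.indicator_le_self' (fun _ _ => zero_le_one) _
      _ = Fintype.card ι := by simp
  let D : C → (ι → Y) → ℝ := fun c S => ⨆ a, |empirical S (A a) - (p c : Measure Y).real (A a)|
  have hbdd : ∀ (c : C) (S : ι → Y), BddAbove (Set.range fun a =>
      |empirical S (A a) - (p c : Measure Y).real (A a)|) := by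
    refine fun c S => ⟨1, ?_⟩
    rintro _ ⟨a, rfl⟩
    have h1 : (p c : Measure Y).real (A a) ≤ 1 := measureReal_le_one
    have h3 : 0 ≤ (p c : Measure Y).real (A a) := measureReal_nonneg
    simp only [abs_le]
    constructor <;> linarith [hemp0 S (A a), hemp1 S (A a)]
  obtain ⟨sel, hsel, hmin⟩ := exists_measurable_argmin (Ω := ι → Y) D
    (fun c => Measurable.iSup (f := fun a (S : ι → Y) =>
        |empirical S (A a) - (p c : Measure Y).real (A a)|) fun a => by
      have := measurable_empirical (ι := ι) (hA a)
      fun_prop)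
    (fun c S => Real.iSup_nonneg (f := fun a =>
      |empirical S (A a) - (p c : Measure Y).real (A a)|) fun a => abs_nonneg _) hη
  refine ⟨sel, hsel, fun P S t ht i => ?_⟩
  have h1 : D i S ≤ tvDist (p i) P + t := by
    refine ciSup_le fun a => ?_
    have h2 := abs_sub_le_tvDist (p i) P (hA a)
    rw [abs_sub_comm] at h2
    exact (abs_sub_le _ ((P : Measure Y).real (A a)) _).trans (by linarith [ht a])
  -- On the Yatracos set of the pair, `tvDist (p (sel S)) (p i) ≤ D (sel S) S + D i S ≤ 2 * D i S +
  -- η`; one more triangle inequality gives the factor `3`.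
  obtain ⟨a, ha⟩ := hp (sel S) i
  have h2 : ∀ c, |empirical S (A a) - (p c : Measure Y).real (A a)| ≤ D c S := fun c =>
    le_ciSup (hbdd c S) a
  have h3 := abs_sub_le ((p (sel S) : Measure Y).real (A a)) (empirical S (A a))
    ((p i : Measure Y).real (A a))
  rw [abs_sub_comm _ (empirical S (A a))] at h3
  have h4 := tvDist_triangle (p (sel S)) (p i) P
  linarith [h2 (sel S), h2 i, hmin S i]

lemma VCBounded.comp {Y κ κ' : Type*} {A : κ → Set Y} {V : ℕ} (h : VCBounded A V) (e : κ' → κ) :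
    VCBounded (fun a => A (e a)) V := by
  classical
  intro m y s
  refine le_trans (le_of_eq ?_) (h m y (s.image e))
  rw [Finset.image_image]
  rfl

lemma VCBounded.deviation_countable {κ : Type*} [Countable κ] [Nonempty κ] {n V : ℕ}
    (μ : Measure Y) [IsProbabilityMeasure μ] {A : κ → Set Y} (hA : ∀ a, MeasurableSet (A a))
    (hVC : VCBounded A V) (hV : 1 ≤ V) {t : ℝ} (ht : 0 < t) (hn : 6400 * V ≤ t ^ 2 * n) :
    Measure.pi (fun _ : Fin n => μ) {S | ∃ a, t < |empirical S (A a) - μ.real (A a)|} ≤ 1 / 2 := by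
  obtain ⟨e, he⟩ := exists_surjective_nat κ
  have := (hVC.comp e).deviation μ (fun a => hA (e a)) hV ht hn
  simpa only [he.exists] using this

/-- Hoeffding's inequality and a union bound for finitely many sets. -/
lemma deviation_of_fintype {κ : Type*} [Fintype κ] {n : ℕ} (hn : 0 < n)
    (μ : Measure Y) [IsProbabilityMeasure μ] {A : κ → Set Y} (hA : ∀ a, MeasurableSet (A a))
    {t : ℝ} (ht : 0 < t) :
    Measure.pi (fun _ : Fin n => μ) {S | ∃ a, t < |empirical S (A a) - μ.real (A a)|} ≤
      ENNReal.ofReal (2 * Fintype.card κ * Real.exp (-2 * n * t ^ 2)) := by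
  have hn0 : (0 : ℝ) < n := by exact_mod_cast hn
  set μn := Measure.pi fun _ : Fin n => μ
  have hone : ∀ (f : Y → ℝ), Measurable f → (∀ y, f y ∈ Set.Icc (0 : ℝ) 1) →
      μn.real {S | n * t ≤ ∑ i, (f (S i) - ∫ y, f y ∂μ)} ≤ Real.exp (-2 * n * t ^ 2) := by
    intro f hf hf01
    have hind : iIndepFun (fun i (S : Fin n → Y) => f (S i) - ∫ y, f y ∂μ) μn :=
      iIndepFun_pi (μ := fun _ : Fin n => μ) (X := fun _ y => f y - ∫ y, f y ∂μ)
        fun i => (hf.sub_const _).aemeasurable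
    have hsub : ∀ i ∈ (Finset.univ : Finset (Fin n)),
        HasSubgaussianMGF (fun S : Fin n → Y => f (S i) - ∫ y, f y ∂μ)
          ((‖(1 : ℝ) - 0‖₊ / 2) ^ 2) μn := by
      intro i _
      have h0 := hasSubgaussianMGF_of_mem_Icc (μ := μ) hf.aemeasurable
        (Filter.Eventually.of_forall hf01)
      have hmp := measurePreserving_eval (fun _ : Fin n => μ) i
      rw [← hmp.map_eq] at h0
      have h1 := h0.of_map hmp.measurable.aemeasurable
      rw [hmp.map_eq] at h1
      exact h1
    refine (HasSubgaussianMGF.measure_sum_ge_le_of_iIndepFun hind hsub (by positivity)).trans ?_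
    refine le_of_eq ?_
    congr 1
    simp
    field_simp
  have hset : {S : Fin n → Y | ∃ a, t < |empirical S (A a) - μ.real (A a)|} =
      ⋃ a, {S | t < |empirical S (A a) - μ.real (A a)|} := by ext; simp
  rw [hset]
  refine (measure_iUnion_fintype_le _ _).trans ?_
  have hbound : ∀ a, μn {S | t < |empirical S (A a) - μ.real (A a)|} ≤
      ENNReal.ofReal (2 * Real.exp (-2 * n * t ^ 2)) := by
    intro a
    let f : Y → ℝ := (A a).indicator fun _ => 1
    have hf : Measurable f := measurable_const.indicator (hA a)
    have hf01 : ∀ y, f y ∈ Set.Icc (0 : ℝ) 1 := fun y =>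
      ⟨Set.indicator_nonneg (fun _ _ => zero_le_one) _,
        Set.indicator_le_self' (fun _ _ => zero_le_one) _⟩
    have hfi : ∫ y, f y ∂μ = μ.real (A a) := by
      simp only [f]; rw [integral_indicator (hA a)]; simp
    have hfi' : ∫ y, (1 - f y) ∂μ = 1 - μ.real (A a) := by
      rw [integral_sub (integrable_const _), hfi]
      · simp
      · exact (integrable_const _).indicator (hA a)
    have h1 := hone f hf hf01
    -- The lower tail is the upper tail of the complementary indicator.
    have h2 := hone (fun y => 1 - f y) (measurable_const.sub hf) fun y =>
      ⟨sub_nonneg.2 (hf01 y).2, sub_le_self _ (hf01 y).1⟩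
    rw [hfi] at h1
    rw [hfi'] at h2
    have hcov : {S : Fin n → Y | t < |empirical S (A a) - μ.real (A a)|} ⊆
        {S | n * t ≤ ∑ i, (f (S i) - μ.real (A a))} ∪
        {S | n * t ≤ ∑ i, ((1 - f (S i)) - (1 - μ.real (A a)))} := by
      intro S hS
      have e : ∑ i, (f (S i) - μ.real (A a)) = n * (empirical S (A a) - μ.real (A a)) := by
        simp only [empirical, Fintype.card_fin, f, Finset.sum_sub_distrib]
        simp
        field_simp
      have e' : ∑ i, ((1 - f (S i)) - (1 - μ.real (A a))) =
          -∑ i, (f (S i) - μ.real (A a)) := by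
        rw [← Finset.sum_neg_distrib]; exact Finset.sum_congr rfl fun i _ => by ring
      simp only [Set.mem_union, Set.mem_ofPred_eq, e', e, ← mul_neg] at hS ⊢
      rcases lt_abs.1 hS with h | h
      · left; gcongr
      · right; gcongr
    calc μn {S | t < |empirical S (A a) - μ.real (A a)|}
        = ENNReal.ofReal (μn.real {S | t < |empirical S (A a) - μ.real (A a)|}) := by
          exact (ENNReal.ofReal_toReal (measure_ne_top _ _)).symm
      _ ≤ _ := ENNReal.ofReal_le_ofReal <| (measureReal_mono hcov).trans <|
          (measureReal_union_le _ _).trans (by linarith)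
  calc ∑ a, μn {S | t < |empirical S (A a) - μ.real (A a)|}
      ≤ ∑ _a : κ, ENNReal.ofReal (2 * Real.exp (-2 * n * t ^ 2)) :=
        Finset.sum_le_sum fun a _ => hbound a
    _ = _ := by
      rw [Finset.sum_const, Finset.card_univ, nsmul_eq_mul, ← ENNReal.ofReal_natCast,
        ← ENNReal.ofReal_mul (Nat.cast_nonneg _)]
      congr 1; ring

end minimumDistance

/-! ### Splitting a sample into independent blocks. -/

section sampleSplit

variable {X : Type*} [MeasurableSpace X]

lemma measurePreserving_curry {ι κ : Type*} [Fintype ι] [Fintype κ] (μ : Measure X)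
    [IsProbabilityMeasure μ] :
    MeasurePreserving (MeasurableEquiv.curry ι κ X) (Measure.pi fun _ : ι × κ => μ)
      (Measure.pi fun _ : ι => Measure.pi fun _ : κ => μ) := by
  have h : MeasurePreserving (MeasurableEquiv.curry ι κ X).symm
      (Measure.pi fun _ : ι => Measure.pi fun _ : κ => μ) (Measure.pi fun _ : ι × κ => μ) := by
    refine ⟨(MeasurableEquiv.curry ι κ X).symm.measurable, (Measure.pi_eq fun s hs => ?_).symm⟩
    rw [Measure.map_apply (MeasurableEquiv.measurable _)
      (MeasurableSet.univ_pi hs)]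
    have : (MeasurableEquiv.curry ι κ X).symm ⁻¹' (Set.univ.pi s) =
        Set.univ.pi fun i => Set.univ.pi fun j => s (i, j) := by
      ext f
      simp [MeasurableEquiv.curry, Set.mem_pi, Function.uncurry]
    rw [this, Measure.pi_pi]
    simp_rw [Measure.pi_pi]
    rw [Fintype.prod_prod_type]
  exact h.symm

/-- Split a sample into `r` blocks of size `n` and a final block of size `m`. -/
lemma exists_splitSample (r n m : ℕ) :
    ∃ e : (Fin (r * n + m) → X) ≃ᵐ (Fin r → Fin n → X) × (Fin m → X),
      ∀ (μ : Measure X) [IsProbabilityMeasure μ],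
        MeasurePreserving e (Measure.pi fun _ => μ)
          ((Measure.pi fun _ => Measure.pi fun _ => μ).prod (Measure.pi fun _ => μ)) := by
  let f : (Fin r × Fin n) ⊕ Fin m ≃ Fin (r * n + m) :=
    (Equiv.sumCongr finProdFinEquiv (Equiv.refl _)).trans finSumFinEquiv
  refine ⟨((MeasurableEquiv.piCongrLeft (fun _ => X) f).symm.trans
    (MeasurableEquiv.sumPiEquivProdPi fun _ => X)).trans
    (MeasurableEquiv.prodCongr (MeasurableEquiv.curry _ _ X) (MeasurableEquiv.refl _)),
    fun μ _ => ?_⟩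
  have h1 := (measurePreserving_piCongrLeft (fun _ : Fin (r * n + m) => μ) f).symm
  have h2 := measurePreserving_sumPiEquivProdPi fun _ : (Fin r × Fin n) ⊕ Fin m => μ
  have h3 := (measurePreserving_curry (ι := Fin r) (κ := Fin n) μ).prod
    (MeasurePreserving.id (Measure.pi fun _ : Fin m => μ))
  exact h3.comp (h2.comp h1)

end sampleSplit

/-! ### Guessing the labels and selecting a candidate. -/

/-- The two-stage estimator: guess all the labellings of each of `r` unlabelled samples, compute
the minimum distance estimates of the labelled distributions, and choose among their unlabelled
marginals by another minimum distance estimate. -/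
theorem exists_twoStage {X κ : Type*} [MeasurableSpace X] [Countable κ] [Nonempty κ] {k : ℕ}
    [NeZero k] (c : ℕ → ProbabilityMeasure (X × Fin k)) (A : κ → Set (X × Fin k))
    (hA : ∀ a, MeasurableSet (A a))
    (hc : ∀ i j, ∃ a, tvDist (c i) (c j) ≤
      |(c i : Measure (X × Fin k)).real (A a) - (c j : Measure (X × Fin k)).real (A a)|)
    {V : ℕ} (hV : 1 ≤ V) (hVC : VCBounded A V) {t t' η : ℝ} (ht : 0 < t) (ht' : 0 < t')
    (hη : 0 < η) {r n m : ℕ} (hr : 0 < r) (hm : 0 < m) (hn : 6400 * V ≤ t ^ 2 * n) :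
    ∃ T : (Fin (r * n + m) → X) → ProbabilityMeasure X, Measurable T ∧
      ∀ (g : ProbabilityMeasure X) (P : ProbabilityMeasure (X × Fin k)),
        (P : Measure (X × Fin k)).fst = (g : Measure X) → ∀ i,
        sampleLaw g (r * n + m)
          {S | 3 * (3 * tvDist (c i) P + 2 * t + η) + 2 * t' + η < tvDist (T S) g} ≤
          ENNReal.ofReal ((1 / 2) ^ r + 2 * (r * k ^ n) ^ 2 * Real.exp (-2 * m * t' ^ 2)) := by
  classical
  have : NeZero r := ⟨hr.ne'⟩
  obtain ⟨sel, hsel, hselP⟩ := exists_minimumDistance (ι := Fin n) c A hA hc hη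
  let q : ℕ → ProbabilityMeasure X := fun i => (c i).map measurable_fst.aemeasurable
  choose H hH hHq using fun i j => exists_tvDist_le (q i) (q j)
  let C := Fin r × (Fin n → Fin k)
  have hsel2 := fun v : C → ℕ => exists_minimumDistance (ι := Fin m) (fun x : C => q (v x))
    (fun x : C × C => H (v x.1) (v x.2)) (fun _ => hH _ _)
    (fun x y => ⟨(x, y), hHq _ _⟩) hη
  choose sel2 hsel2m hsel2P using hsel2
  let idx : (Fin r → Fin n → X) → C → ℕ := fun S x => sel fun i => (S x.1 i, x.2 i)
  have hidx : Measurable idx := by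
    refine measurable_pi_iff.2 fun x => hsel.comp (measurable_pi_iff.2 fun i => ?_)
    exact ((measurable_pi_apply i).comp (measurable_pi_apply x.1)).prodMk measurable_const
  let out : (C → ℕ) × (Fin m → X) → ProbabilityMeasure X := fun p => q (p.1 (sel2 p.1 p.2))
  have hout : Measurable out := by
    -- The second selector depends on the candidate list `v`, but there are only countably many
    -- lists, so joint measurability can be checked for each `v`.
    refine measurable_from_prod_countable_right fun v => ?_
    exact (measurable_of_finite fun x : C => q (v x)).comp (hsel2m v)
  obtain ⟨e, he⟩ := exists_splitSample (X := X) r n m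
  refine ⟨fun S => out (idx (e S).1, (e S).2),
    hout.comp ((hidx.comp (measurable_fst.comp e.measurable)).prodMk
      (measurable_snd.comp e.measurable)), fun g P hP i => ?_⟩
  set b := 3 * tvDist (c i) P + 2 * t + η with hb
  -- the blocks for which no labelling leads to a good estimate
  let B : Set (Fin n → X) :=
    {s | ∀ a : Fin n → Fin k, b < tvDist (c (sel fun i => (s i, a i))) P}
  have hB : MeasurableSet B := by
    simp only [B, Set.ofPred_forall]
    refine MeasurableSet.iInter fun a => ?_
    have h1 : Measurable fun s : Fin n → X => sel fun i => (s i, a i) :=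
      hsel.comp (measurable_pi_iff.2 fun i => by fun_prop)
    exact h1 (MeasurableSet.of_discrete (s := {j | b < tvDist (c j) P}))
  -- A sample of `P` projects to a sample of `g`. If every labelling of the projection fails, so
  -- does the one drawn from `P`, and that has probability at most `1 / 2`.
  have hBhalf : Measure.pi (fun _ : Fin n => (g : Measure X)) B ≤ 1 / 2 := by
    have hmp : MeasurePreserving (fun (s : Fin n → X × Fin k) i => (s i).1)
        (Measure.pi fun _ => (P : Measure (X × Fin k))) (Measure.pi fun _ => (g : Measure X)) :=
      measurePreserving_pi _ _ fun _ => ⟨measurable_fst, hP⟩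
    rw [← hmp.measure_preimage hB.nullMeasurableSet]
    refine le_trans (measure_mono fun s hs => ?_)
      (hVC.deviation_countable (P : Measure (X × Fin k)) hA hV ht hn)
    by_contra hcon
    simp only [Set.mem_ofPred_eq, not_exists, not_lt] at hcon
    have h1 := hselP P s t hcon i
    have h2 : b < tvDist (c (sel s)) P := hs fun j => (s j).2
    linarith
  -- the samples for the second stage which are not representative
  let D : Set ((C → ℕ) × (Fin m → X)) := {p | ∃ x : C × C, t' <
    |empirical p.2 (H (p.1 x.1) (p.1 x.2)) - (g : Measure X).real (H (p.1 x.1) (p.1 x.2))|}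
  have hD : MeasurableSet D := by
    have : D = ⋃ v : C → ℕ, ({v} : Set (C → ℕ)) ×ˢ {s : Fin m → X | ∃ x : C × C, t' <
        |empirical s (H (v x.1) (v x.2)) - (g : Measure X).real (H (v x.1) (v x.2))|} := by
      ext ⟨v, s⟩
      simp [D]
    rw [this]
    refine MeasurableSet.iUnion fun v => (measurableSet_singleton v).prod ?_
    rw [Set.ofPred_exists]
    refine MeasurableSet.iUnion fun x => measurableSet_lt measurable_const ?_
    have := measurable_empirical (ι := Fin m) (hH (v x.1) (v x.2))
    fun_prop
  set β : ℝ := 2 * (r * k ^ n) ^ 2 * Real.exp (-2 * m * t' ^ 2)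
  -- Given the first-stage blocks the candidates are fixed and the last block is fresh, so Hoeffding
  -- applies to the `(r k ^ n)²` sets of pairs of candidates.
  have hDv : ∀ v : C → ℕ, Measure.pi (fun _ : Fin m => (g : Measure X)) (Prod.mk v ⁻¹' D) ≤
      ENNReal.ofReal β := by
    intro v
    refine (deviation_of_fintype hm (g : Measure X) (A := fun x : C × C => H (v x.1) (v x.2))
      (fun _ => hH _ _) ht').trans (le_of_eq ?_)
    simp only [β, C, Fintype.card_prod, Fintype.card_fin, Fintype.card_fun]
    push_cast
    ring_nf
  let E : Set ((Fin r → Fin n → X) × (Fin m → X)) :=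
    (Set.univ.pi fun _ => B) ×ˢ Set.univ ∪ (fun p => (idx p.1, p.2)) ⁻¹' D
  have hsub : {S | 3 * b + 2 * t' + η < tvDist (out (idx (e S).1, (e S).2)) g} ⊆ e ⁻¹' E := by
    intro S hS
    by_contra hcon
    simp only [E, Set.mem_preimage, Set.mem_union, Set.mem_prod, Set.mem_univ, and_true,
      not_or] at hcon
    obtain ⟨h1, h2⟩ := hcon
    simp only [B, Set.mem_pi, Set.mem_univ, true_imp_iff, Set.mem_ofPred_eq, not_forall,
      not_lt] at h1
    obtain ⟨l, a, hla⟩ := h1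
    simp only [D, Set.mem_ofPred_eq, not_exists, not_lt] at h2
    have h3 := hsel2P (idx (e S).1) g (e S).2 t' h2 (l, a)
    have hmap : P.map measurable_fst.aemeasurable = g := Subtype.ext hP
    have h4 := tvDist_map_le (c (idx (e S).1 (l, a))) P measurable_fst
    rw [hmap] at h4
    have h5 : tvDist (c (idx (e S).1 (l, a))) P ≤ b := hla
    have h6 : 3 * b + 2 * t' + η <
      tvDist (q (idx (e S).1 (sel2 (idx (e S).1) (e S).2))) g := hS
    have h7 : tvDist (q (idx (e S).1 (l, a))) g ≤ tvDist (c (idx (e S).1 (l, a))) P := h4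
    linarith
  calc sampleLaw g (r * n + m) {S | 3 * b + 2 * t' + η < tvDist (out (idx (e S).1, (e S).2)) g}
      ≤ sampleLaw g (r * n + m) (e ⁻¹' E) := measure_mono hsub
    _ = _ := (he (g : Measure X)).measure_preimage_equiv E
    _ ≤ _ := measure_union_le _ _
    _ ≤ ENNReal.ofReal ((1 / 2) ^ r) + ENNReal.ofReal β := by
        refine add_le_add ?_ ?_
        · rw [Measure.prod_prod, measure_univ, mul_one, Measure.pi_pi, Finset.prod_const,
            Finset.card_univ, Fintype.card_fin, ENNReal.ofReal_pow (by norm_num)]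
          gcongr
          refine hBhalf.trans (le_of_eq ?_)
          rw [ENNReal.ofReal_div_of_pos (by norm_num)]; simp
        · have hD' : MeasurableSet ((fun p : (Fin r → Fin n → X) × (Fin m → X) =>
              (idx p.1, p.2)) ⁻¹' D) := (hidx.comp measurable_fst).prodMk measurable_snd hD
          rw [Measure.prod_apply hD']
          refine (lintegral_mono fun S => hDv (idx S)).trans (le_of_eq ?_)
          rw [lintegral_const, measure_univ, mul_one]
    _ = _ := (ENNReal.ofReal_add (by positivity) (by positivity)).symm

/-! ### VC dimension of positivity sets. -/

/-- The positivity sets of linear combinations of finitely many functions have VC dimension at most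
the number of functions. -/
lemma vcBounded_of_features {Y κ J : Type*} [Fintype J] (ψ : J → Y → ℝ) (A : κ → Set Y)
    (h : ∀ a, ∃ c : J → ℝ, ∀ y, y ∈ A a ↔ 0 < ∑ j, c j * ψ j y) :
    VCBounded A (Fintype.card J) := by
  classical
  intro n y s
  refine Finset.sup_le fun U hU => ?_
  rw [Finset.mem_shatterer] at hU
  by_contra hcard
  have hdep : ¬ LinearIndependent ℝ fun (i : U) (j : J) => ψ j (y i) := fun hli => by
    have := hli.fintype_card_le_finrank
    simp at this
    omega
  obtain ⟨l, hl, i₀, hi₀⟩ : ∃ l : U → ℝ, (∑ i, l i • fun j : J => ψ j (y i)) = 0 ∧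
      ∃ i, 0 < l i := by
    obtain ⟨l, hl, i₀, hi₀⟩ := Fintype.not_linearIndependent_iff.1 hdep
    rcases lt_or_gt_of_ne hi₀ with h0 | h0
    · exact ⟨fun i => -l i, by simpa [neg_smul] using hl, i₀, by simpa using h0⟩
    · exact ⟨l, hl, i₀, h0⟩
  -- Shattering gives a function positive exactly at the points with positive coefficient. The
  -- linear relation makes its weighted sum zero, while no term is negative and one is positive.
  obtain ⟨W, hW, hWt⟩ := hU (t := (Finset.univ.filter fun i : U => 0 < l i).map
    (Function.Embedding.subtype _)) (fun i hi => by
      obtain ⟨i, -, rfl⟩ := Finset.mem_map.1 hi; exact i.2)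
  obtain ⟨a, -, rfl⟩ := Finset.mem_image.1 hW
  obtain ⟨c, hc⟩ := h a
  have hsign : ∀ i : U, 0 < ∑ j, c j * ψ j (y i) ↔ 0 < l i := by
    intro i
    have := congrArg ((i : Fin n) ∈ ·) hWt
    simp only [Finset.mem_inter, i.2, Finset.mem_filter, Finset.mem_univ, true_and, hc,
      Finset.mem_map, Function.Embedding.coe_subtype, eq_iff_iff] at this
    rw [this]
    constructor
    · rintro ⟨i', h1, h2⟩
      rwa [← Subtype.ext h2]
    · exact fun h1 => ⟨i, h1, rfl⟩
  have hzero : ∑ i : U, l i * ∑ j, c j * ψ j (y i) = 0 := by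
    calc ∑ i : U, l i * ∑ j, c j * ψ j (y i) =
          ∑ j, c j * ∑ i : U, l i * ψ j (y i) := by
          simp only [Finset.mul_sum]
          rw [Finset.sum_comm]
          exact Finset.sum_congr rfl fun _ _ => Finset.sum_congr rfl fun _ _ => by ring
      _ = 0 := Finset.sum_eq_zero fun j _ => by
          have := congrFun hl j
          simp only [Finset.sum_apply, Pi.smul_apply, smul_eq_mul, Pi.zero_apply] at this
          rw [this, mul_zero]
  have hpos : 0 < ∑ i : U, l i * ∑ j, c j * ψ j (y i) := by
    refine Finset.sum_pos' (fun i _ => ?_) ⟨i₀, Finset.mem_univ _, mul_pos hi₀ ((hsign i₀).2 hi₀)⟩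
    rcases lt_or_ge 0 (l i) with h0 | h0
    · exact (mul_pos h0 ((hsign i).2 h0)).le
    · exact mul_nonneg_of_nonpos_of_nonpos h0 (not_lt.1 fun h1 => absurd ((hsign i).1 h1) (by simpa))
  exact hpos.ne' hzero

/-! ### Gaussian densities as exponentials of quadratic polynomials. -/

section quadratic

variable {d : ℕ}

/-- The monomials of degree at most two. -/
def quadMonomial (d : ℕ) :
    Unit ⊕ Fin d ⊕ Fin d × Fin d → EuclideanSpace ℝ (Fin d) → ℝ
  | .inl _, _ => 1
  | .inr (.inl i), x => x i
  | .inr (.inr p), x => x p.1 * x p.2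

variable (d) in
/-- The space of polynomial functions of degree at most two. -/
def quadSpace : Submodule ℝ (EuclideanSpace ℝ (Fin d) → ℝ) :=
  Submodule.span ℝ (Set.range (quadMonomial d))

lemma const_mem_quadSpace (c : ℝ) : (fun _ => c) ∈ quadSpace d := by
  have h : quadMonomial d (.inl ()) ∈ quadSpace d := Submodule.subset_span ⟨_, rfl⟩
  convert Submodule.smul_mem _ c h using 1
  ext x
  simp [quadMonomial]

lemma sq_affine_mem_quadSpace (a : Fin d → ℝ) (b : ℝ) :
    (fun x : EuclideanSpace ℝ (Fin d) => (∑ j, a j * x j + b) ^ 2) ∈ quadSpace d := by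
  have h1 : ∀ i, quadMonomial d (.inr (.inl i)) ∈ quadSpace d :=
    fun i => Submodule.subset_span ⟨_, rfl⟩
  have h2 : ∀ p, quadMonomial d (.inr (.inr p)) ∈ quadSpace d :=
    fun p => Submodule.subset_span ⟨_, rfl⟩
  have h3 : ∑ i, ∑ j, (a i * a j) • quadMonomial d (.inr (.inr (i, j))) +
      ∑ i, (2 * b * a i) • quadMonomial d (.inr (.inl i)) + (fun _ => b ^ 2) ∈ quadSpace d :=
    add_mem (add_mem (sum_mem fun i _ => sum_mem fun j _ => Submodule.smul_mem _ _ (h2 _))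
      (sum_mem fun i _ => Submodule.smul_mem _ _ (h1 _))) (const_mem_quadSpace _)
  convert h3 using 1
  ext x
  simp only [Pi.add_apply, Finset.sum_apply, Pi.smul_apply, smul_eq_mul, quadMonomial]
  rw [add_sq, sq (∑ j, a j * x j), Finset.sum_mul_sum, Finset.mul_sum, Finset.sum_mul]
  congr 2
  · exact Finset.sum_congr rfl fun i _ => Finset.sum_congr rfl fun j _ => by ring
  · exact Finset.sum_congr rfl fun i _ => by ring

lemma measurable_of_mem_quadSpace {h : EuclideanSpace ℝ (Fin d) → ℝ} (hh : h ∈ quadSpace d) :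
    Measurable h := by
  induction hh using Submodule.span_induction with
  | mem h hh =>
    obtain ⟨i | i | p, rfl⟩ := hh
    · exact measurable_const
    · change Measurable fun x : EuclideanSpace ℝ (Fin d) => x i
      fun_prop
    · change Measurable fun x : EuclideanSpace ℝ (Fin d) => x p.1 * x p.2
      fun_prop
  | zero => exact measurable_const
  | add f g _ _ hf hg => exact hf.add hg
  | smul c f _ hf => exact hf.const_smul c

lemma map_withDensity_of_leftInverse {Ω Ω' : Type*} [MeasurableSpace Ω] [MeasurableSpace Ω']
    (μ : Measure Ω) {ρ : Ω → ENNReal} (hρ : Measurable ρ) {f : Ω → Ω'} {g : Ω' → Ω}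
    (hf : Measurable f) (hg : Measurable g) (hgf : ∀ x, g (f x) = x) :
    (μ.withDensity ρ).map f = (μ.map f).withDensity (fun y => ρ (g y)) := by
  ext B hB
  rw [Measure.map_apply hf hB, withDensity_apply _ (hf hB), withDensity_apply _ hB,
    setLIntegral_map (f := fun y => ρ (g y)) hB (hρ.comp hg) hf]
  simp only [hgf]

lemma pi_gaussianReal_eq_withDensity (ι : Type*) [Fintype ι] :
    Measure.pi (fun _ : ι => gaussianReal 0 1) =
      volume.withDensity fun x => ENNReal.ofReal (∏ i, gaussianPDFReal 0 1 (x i)) := by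
  refine Measure.pi_eq fun s hs => ?_
  rw [withDensity_apply _ (MeasurableSet.univ_pi hs), volume_pi, Measure.restrict_pi_pi,
    ← ofReal_integral_eq_lintegral_ofReal]
  · rw [integral_fintype_prod_eq_prod (μ := fun i => volume.restrict (s i))
      (f := fun (_ : ι) (y : ℝ) => gaussianPDFReal 0 1 y),
      ENNReal.ofReal_prod_of_nonneg fun i _ => integral_nonneg (gaussianPDFReal_nonneg 0 1)]
    exact Finset.prod_congr rfl fun i _ =>
      (gaussianReal_apply_eq_integral 0 one_ne_zero (s i)).symm
  · exact Integrable.fintype_prod (μ := fun i => volume.restrict (s i))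
      (f := fun (_ : ι) (y : ℝ) => gaussianPDFReal 0 1 y)
      fun i => (integrable_gaussianPDFReal 0 1).restrict
  · exact Filter.Eventually.of_forall fun x =>
      Finset.prod_nonneg fun i _ => gaussianPDFReal_nonneg 0 1 _

lemma exists_stdGaussian_eq_withDensity (d : ℕ) :
    ∃ C : ℝ, stdGaussian (EuclideanSpace ℝ (Fin d)) = volume.withDensity fun x =>
      ENNReal.ofReal (Real.exp (C - (∑ i, x i ^ 2) / 2)) := by
  refine ⟨d * Real.log (Real.sqrt (2 * Real.pi * (1 : NNReal)))⁻¹, ?_⟩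
  rw [← map_pi_eq_stdGaussian, pi_gaussianReal_eq_withDensity,
    map_withDensity_of_leftInverse (g := WithLp.ofLp) _ _ (by fun_prop) (by fun_prop)
      (fun x => rfl), (PiLp.volume_preserving_toLp (Fin d)).map_eq]
  · congr 1
    ext x
    congr 1
    have hpos : 0 < (Real.sqrt (2 * Real.pi * (1 : NNReal)))⁻¹ := by
      have := Real.pi_pos
      simp; positivity
    simp only [gaussianPDFReal]
    rw [Finset.prod_mul_distrib, Finset.prod_const, Finset.card_univ, Fintype.card_fin,
      ← Real.exp_sum, sub_eq_add_neg, Real.exp_add, Real.exp_nat_mul, Real.exp_log hpos]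
    congr 2
    simp [Finset.sum_div, Finset.sum_neg_distrib, neg_div]
  · exact (Finset.measurable_prod _ fun i _ =>
      (measurable_gaussianPDFReal 0 1).comp (measurable_pi_apply i)).ennreal_ofReal

/-- A nondegenerate Gaussian distribution has a density that is the exponential of a polynomial
of degree at most two. -/
lemma exists_multivariateGaussian_eq_withDensity (μ : EuclideanSpace ℝ (Fin d))
    {S : Matrix (Fin d) (Fin d) ℝ} (hS : S.PosDef) :
    ∃ h ∈ quadSpace d, multivariateGaussian μ S =
      volume.withDensity fun x => ENNReal.ofReal (Real.exp (h x)) := by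
  open scoped MatrixOrder Matrix.Norms.L2Operator in
  -- The Gaussian is the image of the standard one under `x ↦ μ + Q x`, invertible because `S` is
  -- positive definite; the Jacobian enters the exponent as `Real.log c`.
  set Q : Matrix (Fin d) (Fin d) ℝ := CFC.sqrt S with hQ
  have hQQ : Q * Q = S := by
    open scoped MatrixOrder Matrix.Norms.L2Operator in
    exact CFC.sqrt_mul_sqrt_self _ hS.posSemidef.nonneg
  have hQu : IsUnit Q.det := by
    have h1 : IsUnit S.det := hS.det_pos.ne'.isUnit
    rw [← hQQ, Matrix.det_mul] at h1
    exact isUnit_of_mul_isUnit_left h1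
  obtain ⟨C, hC⟩ := exists_stdGaussian_eq_withDensity d
  set L := Matrix.toEuclideanCLM (𝕜 := ℝ) Q
  set R := Matrix.toEuclideanCLM (𝕜 := ℝ) Q⁻¹
  have hRL : ∀ x, R (L x) = x := by
    intro x
    rw [← mul_apply_eq_comp, ← map_mul, Matrix.nonsing_inv_mul _ hQu, map_one]
    rfl
  have hdet : LinearMap.det (L : EuclideanSpace ℝ (Fin d) →ₗ[ℝ] EuclideanSpace ℝ (Fin d)) ≠ 0 := by
    intro h0
    have h1 : (R : EuclideanSpace ℝ (Fin d) →ₗ[ℝ] EuclideanSpace ℝ (Fin d)) ∘ₗ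
        (L : EuclideanSpace ℝ (Fin d) →ₗ[ℝ] EuclideanSpace ℝ (Fin d)) = LinearMap.id :=
      LinearMap.ext hRL
    have h2 := congrArg LinearMap.det h1
    rw [LinearMap.det_comp, h0, mul_zero, LinearMap.det_id] at h2
    exact zero_ne_one h2
  set c : ℝ := |(LinearMap.det (L : EuclideanSpace ℝ (Fin d) →ₗ[ℝ] EuclideanSpace ℝ (Fin d)))⁻¹|
  have hc : 0 < c := abs_pos.2 (inv_ne_zero hdet)
  have hvol : (volume : Measure (EuclideanSpace ℝ (Fin d))).map (fun x => μ + L x) =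
      ENNReal.ofReal c • volume := by
    have h1 : (fun x => μ + L x) = (fun x => μ + x) ∘ L := rfl
    rw [h1, ← Measure.map_map (measurable_const_add μ) (by fun_prop)]
    have h2 := Measure.map_linearMap_addHaar_eq_smul_addHaar
      (volume : Measure (EuclideanSpace ℝ (Fin d))) hdet
    rw [ContinuousLinearMap.coe_coe] at h2
    rw [h2, Measure.map_smul, (measurePreserving_add_left volume μ).map_eq]
  refine ⟨fun x => (Real.log c + C) - (∑ i, (R (x - μ)) i ^ 2) / 2, ?_, ?_⟩
  · have h1 : ∀ i, (fun x : EuclideanSpace ℝ (Fin d) => (R (x - μ)) i ^ 2) ∈ quadSpace d := by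
      intro i
      convert sq_affine_mem_quadSpace (Q⁻¹ i) (-∑ j, Q⁻¹ i j * μ j) using 1
      ext x
      congr 1
      simp [R, Matrix.mulVec, dotProduct, sub_eq_add_neg]
    convert sub_mem (const_mem_quadSpace (d := d) (Real.log c + C))
      (Submodule.smul_mem _ (1 / 2 : ℝ) (sum_mem fun i (_ : i ∈ Finset.univ) => h1 i)) using 1
    ext x
    simp only [Pi.sub_apply, Pi.smul_apply, Finset.sum_apply, smul_eq_mul]
    ring
  · have hmeas : Measurable fun x : EuclideanSpace ℝ (Fin d) =>
        ENNReal.ofReal (Real.exp (C - (∑ i, x i ^ 2) / 2)) := by fun_prop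
    rw [multivariateGaussian, hC, map_withDensity_of_leftInverse (g := fun y => R (y - μ)) _ hmeas
      (by fun_prop) (by fun_prop) (fun x => by
        rw [add_sub_cancel_left]; exact hRL x), hvol, withDensity_smul_measure,
      ← withDensity_smul _ (by fun_prop)]
    congr 1
    ext x
    rw [Pi.smul_apply, smul_eq_mul, ← ENNReal.ofReal_mul hc.le]
    congr 1
    beta_reduce
    rw [add_sub_assoc, Real.exp_add, Real.exp_log hc]

end quadratic

/-! ### Reduction to a countable class. -/

/-- A nonempty family of distributions with densities has a countable subfamily that is dense in
total variation. -/
lemma exists_seq_dense_tvDist {Y : Type*} [MeasurableSpace Y]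
    [MeasurableSpace.CountablyGenerated Y] (ν : Measure Y) [SFinite ν]
    {F : Set (ProbabilityMeasure Y)} (hF : F.Nonempty)
    (hFν : ∀ p ∈ F, ∃ f : Y → ℝ, Measurable f ∧ (∀ y, 0 ≤ f y) ∧
      (p : Measure Y) = ν.withDensity fun y => ENNReal.ofReal (f y)) :
    ∃ c : ℕ → ProbabilityMeasure Y, (∀ n, c n ∈ F) ∧
      ∀ p ∈ F, ∀ η : ℝ, 0 < η → ∃ n, tvDist (c n) p ≤ η := by
  have hint : ∀ p : F, ∃ f : Y → ℝ, Integrable f ν ∧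
      ∀ B, MeasurableSet B → (p.1 : Measure Y).real B = ∫ y in B, f y ∂ν := by
    rintro ⟨p, hp⟩
    obtain ⟨f, hfm, hf0, hpf⟩ := hFν p hp
    have hf : Integrable f ν := by
      refine ⟨hfm.aestronglyMeasurable, ?_⟩
      rw [hasFiniteIntegral_iff_ofReal (Filter.Eventually.of_forall hf0)]
      have : ∫⁻ y, ENNReal.ofReal (f y) ∂ν = (p : Measure Y) Set.univ := by
        rw [hpf, withDensity_apply _ MeasurableSet.univ, Measure.restrict_univ]
      rw [this]
      exact measure_lt_top _ _
    refine ⟨f, hf, fun B hB => ?_⟩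
    rw [integral_eq_lintegral_of_nonneg_ae (Filter.Eventually.of_forall hf0)
      hfm.aestronglyMeasurable, Measure.real, hpf, withDensity_apply _ hB]
  choose f hf hfB using hint
  have htv : ∀ p p' : F, tvDist p.1 p'.1 ≤ dist ((hf p).toL1 (f p)) ((hf p').toL1 (f p')) := by
    intro p p'
    refine tvDist_le fun B hB => ?_
    rw [hfB p B hB, hfB p' B hB, ← integral_sub (hf p).integrableOn (hf p').integrableOn,
      dist_eq_norm, ← Integrable.toL1_sub, Integrable.norm_toL1_eq_lintegral_norm,
      ← integral_eq_lintegral_of_nonneg_ae (Filter.Eventually.of_forall fun _ => norm_nonneg _)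
        ((hf p).sub (hf p')).norm.aestronglyMeasurable]
    exact (norm_integral_le_integral_norm _).trans
      (setIntegral_le_integral ((hf p).sub (hf p')).norm
        (Filter.Eventually.of_forall fun _ => norm_nonneg _))
  have : Nonempty F := hF.to_subtype
  let φ : F → (Y →₁[ν] ℝ) := fun p => (hf p).toL1 (f p)
  have : Fact ((1 : ENNReal) ≠ ⊤) := ⟨ENNReal.one_ne_top⟩
  have : SecondCountableTopology (Y →₁[ν] ℝ) := inferInstance
  -- Separability of `L¹` passes to the set of densities, so the approximating sequence can be taken
  -- inside `F`.
  obtain ⟨u, hu⟩ := TopologicalSpace.exists_dense_seq (Set.range φ)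
  have hmem : ∀ n, ∃ p, φ p = (u n).1 := fun n => (u n).2
  choose c hc using hmem
  refine ⟨fun n => (c n).1, fun n => (c n).2, fun p hp η hη => ?_⟩
  obtain ⟨n, hn⟩ := hu.exists_dist_lt ⟨φ ⟨p, hp⟩, ⟨⟨p, hp⟩, rfl⟩⟩ hη
  refine ⟨n, (htv (c n) ⟨p, hp⟩).trans ?_⟩
  rw [dist_comm, Subtype.dist_eq] at hn
  change dist (φ (c n)) (φ ⟨p, hp⟩) ≤ η
  rw [hc]
  exact hn.le

/-! ### Labelled mixtures and their Yatracos sets. -/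

section joint

variable {d k : ℕ}

/-- The distributions on labelled points that, for every label, have a density that is a
nonnegative multiple of the exponential of a polynomial of degree at most two. -/
def labelledMixtures (d k : ℕ) : Set (ProbabilityMeasure (EuclideanSpace ℝ (Fin d) × Fin k)) :=
  {p | ∃ (w : Fin k → ℝ) (h : Fin k → EuclideanSpace ℝ (Fin d) → ℝ), (∀ i, 0 ≤ w i) ∧
    (∀ i, h i ∈ quadSpace d) ∧
    (p : Measure (EuclideanSpace ℝ (Fin d) × Fin k)) =
      ((volume : Measure (EuclideanSpace ℝ (Fin d))).prod Measure.count).withDensity fun y =>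
        ENNReal.ofReal (w y.2 * Real.exp (h y.2 y.1))}

lemma measurable_labelledDensity (w : Fin k → ℝ) {h : Fin k → EuclideanSpace ℝ (Fin d) → ℝ}
    (hh : ∀ i, h i ∈ quadSpace d) :
    Measurable fun y : EuclideanSpace ℝ (Fin d) × Fin k => w y.2 * Real.exp (h y.2 y.1) :=
  measurable_from_prod_countable_left fun i =>
    (Real.measurable_exp.comp (measurable_of_mem_quadSpace (hh i))).const_mul (w i)

/-- Every mixture of Gaussians is the marginal of a distribution on labelled points. -/
lemma exists_labelledMixture {f : ProbabilityMeasure (EuclideanSpace ℝ (Fin d))}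
    (hf : f ∈ mixtures (gaussians d) k) :
    ∃ p ∈ labelledMixtures d k,
      (p : Measure (EuclideanSpace ℝ (Fin d) × Fin k)).fst =
        (f : Measure (EuclideanSpace ℝ (Fin d))) := by
  obtain ⟨w, hw, g, hg, hfg⟩ := hf
  have hdens : ∀ i, ∃ h ∈ quadSpace d, (g i : Measure (EuclideanSpace ℝ (Fin d))) =
      volume.withDensity fun x => ENNReal.ofReal (Real.exp (h x)) := by
    intro i
    obtain ⟨μ, S, hS, h⟩ := hg i
    rw [h]
    exact exists_multivariateGaussian_eq_withDensity μ hS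
  choose h hh hgh using hdens
  set p := ((volume : Measure (EuclideanSpace ℝ (Fin d))).prod
    (Measure.count : Measure (Fin k))).withDensity fun y =>
      ENNReal.ofReal (w y.2 * Real.exp (h y.2 y.1)) with hp
  have hm := (measurable_labelledDensity w hh).ennreal_ofReal
  have hfst : p.fst = (f : Measure (EuclideanSpace ℝ (Fin d))) := by
    ext B hB
    rw [Measure.fst_apply hB, hp, withDensity_apply _ (measurable_fst hB), ← Set.prod_univ,
      ← Measure.prod_restrict, Measure.restrict_univ, lintegral_prod _ hm.aemeasurable, hfg,
      Measure.finsetSum_apply]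
    simp only [lintegral_count, tsum_fintype]
    have hm' : ∀ i, Measurable fun x => ENNReal.ofReal (w i * Real.exp (h i x)) :=
      fun i => hm.comp measurable_prodMk_right
    have hexp : ∀ i, Measurable fun x => ENNReal.ofReal (Real.exp (h i x)) :=
      fun i => (Real.measurable_exp.comp (measurable_of_mem_quadSpace (hh i))).ennreal_ofReal
    rw [lintegral_finsetSum _ fun i _ => hm' i]
    refine Finset.sum_congr rfl fun i _ => ?_
    rw [Measure.smul_apply, hgh i, withDensity_apply _ hB, smul_eq_mul,
      ← lintegral_const_mul _ (hexp i)]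
    refine lintegral_congr fun x => ?_
    rw [ENNReal.ofReal_mul (hw.1 i)]
  have hprob : IsProbabilityMeasure p := ⟨by rw [← Measure.fst_univ, hfst]; exact measure_univ⟩
  exact ⟨⟨p, hprob⟩, ⟨w, h, hw.1, hh, rfl⟩, hfst⟩

lemma mixtures_gaussians_nonempty (d : ℕ) (hk : 0 < k) : (mixtures (gaussians d) k).Nonempty := by
  classical
  let γ : ProbabilityMeasure (EuclideanSpace ℝ (Fin d)) :=
    ⟨multivariateGaussian 0 (1 : Matrix (Fin d) (Fin d) ℝ), inferInstance⟩
  refine ⟨γ, Pi.single ⟨0, hk⟩ 1, single_mem_stdSimplex ℝ _, fun _ => γ,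
    fun _ => ⟨0, 1, Matrix.PosDef.one, rfl⟩, ?_⟩
  rw [Finset.sum_eq_single ⟨0, hk⟩]
  · simp
  · intro i _ hi
    simp [Pi.single_eq_of_ne hi]
  · simp

/-- The Yatracos sets of a sequence of labelled mixtures have VC dimension at most the dimension of
the space of `k`-tuples of polynomials of degree at most two. -/
lemma exists_yatracos (c : ℕ → ProbabilityMeasure (EuclideanSpace ℝ (Fin d) × Fin k))
    (hc : ∀ n, c n ∈ labelledMixtures d k) :
    ∃ A : ℕ × ℕ → Set (EuclideanSpace ℝ (Fin d) × Fin k), (∀ a, MeasurableSet (A a)) ∧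
      (∀ i j, ∃ a, tvDist (c i) (c j) ≤
        |(c i : Measure (EuclideanSpace ℝ (Fin d) × Fin k)).real (A a) -
          (c j : Measure (EuclideanSpace ℝ (Fin d) × Fin k)).real (A a)|) ∧
      VCBounded A ((1 + (d + d * d)) * k) := by
  classical
  choose w h hw hh hwh using hc
  refine ⟨fun a => {y | w a.2 y.2 * Real.exp (h a.2 y.2 y.1) <
    w a.1 y.2 * Real.exp (h a.1 y.2 y.1)},
    fun a => measurableSet_lt (measurable_labelledDensity _ (hh _))
      (measurable_labelledDensity _ (hh _)),
    fun i j => ⟨(i, j), tvDist_withDensity_le (measurable_labelledDensity _ (hh _))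
      (measurable_labelledDensity _ (hh _)) (hwh i) (hwh j)⟩, ?_⟩
  -- The features are monomials times label indicators, so that each label has its own quadratic.
  let ψ : (Unit ⊕ Fin d ⊕ Fin d × Fin d) × Fin k → EuclideanSpace ℝ (Fin d) × Fin k → ℝ :=
    fun t y => if t.2 = y.2 then quadMonomial d t.1 y.1 else 0
  have hcard : (1 + (d + d * d)) * k =
      Fintype.card ((Unit ⊕ Fin d ⊕ Fin d × Fin d) × Fin k) := by simp
  rw [hcard]
  refine vcBounded_of_features ψ _ fun a => ?_
  have hq : ∀ l : Fin k, ∃ q ∈ quadSpace d, ∀ x,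
      w a.2 l * Real.exp (h a.2 l x) < w a.1 l * Real.exp (h a.1 l x) ↔ 0 < q x := by
    intro l
    -- Logarithms can be compared only for positive weights; for a zero weight the constants `0` and
    -- `1` serve as the quadratic.
    rcases (hw a.1 l).eq_or_lt with h1 | h1
    · refine ⟨fun _ => 0, const_mem_quadSpace 0, fun x => ?_⟩
      have h2 := mul_nonneg (hw a.2 l) (Real.exp_pos (h a.2 l x)).le
      rw [← h1, zero_mul]
      simpa using h2
    · rcases (hw a.2 l).eq_or_lt with h2 | h2
      · refine ⟨fun _ => 1, const_mem_quadSpace 1, fun x => ?_⟩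
        have h3 := mul_pos h1 (Real.exp_pos (h a.1 l x))
        rw [← h2, zero_mul]
        simpa using h3
      · refine ⟨(fun _ => Real.log (w a.1 l) - Real.log (w a.2 l)) + (h a.1 l - h a.2 l),
          add_mem (const_mem_quadSpace _) (sub_mem (hh _ _) (hh _ _)), fun x => ?_⟩
        rw [← Real.log_lt_log_iff (mul_pos h2 (Real.exp_pos _)) (mul_pos h1 (Real.exp_pos _)),
          Real.log_mul h2.ne' (Real.exp_pos _).ne', Real.log_mul h1.ne' (Real.exp_pos _).ne',
          Real.log_exp, Real.log_exp, ← sub_pos]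
        simp only [Pi.add_apply, Pi.sub_apply]
        rw [show Real.log (w a.1 l) - Real.log (w a.2 l) + (h a.1 l x - h a.2 l x) =
          Real.log (w a.1 l) + h a.1 l x - (Real.log (w a.2 l) + h a.2 l x) by ring]
  choose q hqmem hqiff using hq
  have hcoef : ∀ l, ∃ b : Unit ⊕ Fin d ⊕ Fin d × Fin d → ℝ, ∑ t, b t • quadMonomial d t = q l :=
    fun l => (Submodule.mem_span_range_iff_exists_fun ℝ).1 (hqmem l)
  choose b hb using hcoef
  refine ⟨fun t => b t.2 t.1, fun y => ?_⟩
  have hsum : ∑ t, b t.2 t.1 * ψ t y = q y.2 y.1 := by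
    rw [← hb, Fintype.sum_prod_type, Finset.sum_apply]
    refine Finset.sum_congr rfl fun t _ => ?_
    simp [ψ]
  rw [hsum, ← hqiff]
  rfl

end joint

lemma opt_nonneg {X : Type*} [MeasurableSpace X] (F : Set (ProbabilityMeasure X))
    (g : ProbabilityMeasure X) : 0 ≤ opt F g :=
  Real.iInf_nonneg fun f => mul_nonneg zero_le_two (tvDist_nonneg f.1 g)

/-- The two-stage estimator for mixtures of Gaussians, for given sample sizes. -/
lemma exists_mixture_estimator (d : ℕ) {k : ℕ} (hk : 0 < k) {τ : ℝ} (hτ : 0 < τ) {r n m : ℕ}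
    (hr : 0 < r) (hm : 0 < m) (hn : 6400 * (((1 + (d + d * d)) * k : ℕ) : ℝ) ≤ τ ^ 2 * n) :
    ∃ T : (Fin (r * n + m) → EuclideanSpace ℝ (Fin d)) →
        ProbabilityMeasure (EuclideanSpace ℝ (Fin d)),
      Measurable T ∧ ∀ g : ProbabilityMeasure (EuclideanSpace ℝ (Fin d)),
        sampleLaw g (r * n + m)
          {S | ¬ IsAgnosticApprox (mixtures (gaussians d) k) (64 * τ) 9 (T S) g} ≤
          ENNReal.ofReal ((1 / 2) ^ r + 2 * (r * k ^ n) ^ 2 * Real.exp (-2 * m * τ ^ 2)) := by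
  have : NeZero k := ⟨hk.ne'⟩
  have hne := mixtures_gaussians_nonempty d hk
  obtain ⟨c, hcmem, hcdense⟩ := exists_seq_dense_tvDist
    ((volume : Measure (EuclideanSpace ℝ (Fin d))).prod (Measure.count : Measure (Fin k)))
    (F := labelledMixtures d k)
    (by obtain ⟨f, hf⟩ := hne
        obtain ⟨p, hp, -⟩ := exists_labelledMixture hf
        exact ⟨p, hp⟩)
    (by rintro p ⟨w, h, hw, hh, hp⟩
        exact ⟨_, measurable_labelledDensity w hh,
          fun y => mul_nonneg (hw _) (Real.exp_pos _).le, hp⟩)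
  obtain ⟨A, hA, hAc, hVC⟩ := exists_yatracos c hcmem
  have hV : 1 ≤ (1 + (d + d * d)) * k := Nat.mul_pos (by omega) hk
  obtain ⟨T, hT, hTg⟩ := exists_twoStage c A hA hAc hV hVC hτ hτ hτ hr hm hn
  refine ⟨T, hT, fun g => ?_⟩
  obtain ⟨f, hf⟩ : ∃ f : mixtures (gaussians d) k,
      l1Dist f.1 g < opt (mixtures (gaussians d) k) g + τ := by
    have := hne.to_subtype
    exact exists_lt_of_ciInf_lt (lt_add_of_pos_right _ hτ)
  obtain ⟨J, hJ, hJf⟩ := exists_labelledMixture f.2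
  obtain ⟨i, hi⟩ := hcdense J hJ τ hτ
  -- The conditional law of the label under `J`, applied to `g` as well, gives the labelled target.
  set κ := (J : Measure (EuclideanSpace ℝ (Fin d) × Fin k)).condKernel
  have hJκ : compKernel f.1 κ = J := by
    refine Subtype.ext ?_
    change (f.1 : Measure (EuclideanSpace ℝ (Fin d))) ⊗ₘ κ = J
    rw [← hJf]
    exact Measure.disintegrate _ _
  have hfst : (compKernel g κ : Measure (EuclideanSpace ℝ (Fin d) × Fin k)).fst =
      (g : Measure (EuclideanSpace ℝ (Fin d))) := Measure.fst_compProd _ _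
  refine le_trans (measure_mono fun S hS => ?_) (hTg g (compKernel g κ) hfst i)
  simp only [IsAgnosticApprox, Set.mem_ofPred_eq, not_le] at hS ⊢
  have h1 := tvDist_triangle (c i) J (compKernel g κ)
  have h2 := tvDist_compKernel_le f.1 g κ
  rw [hJκ] at h2
  simp only [l1Dist] at hS hf
  -- The errors in `l1Dist` add up to `51 τ`: `24 τ` from the two stages, `18 τ` from approximating
  -- `J` by `c i`, and `9 τ` from the near-optimality of `f`.
  linarith

/-! ### Choice of the sample sizes. -/

/-- Here `a = log k`, `b = log (k / δ)`, `s = ε⁻²` and `u = k d²`. The lower bounds, from `log 2 >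
0.69` and `ε < 2`, let every term be absorbed into the one product. -/
lemma sampleSize_arith {a b s u r n m : ℝ} (ha : 0.69 ≤ a) (hb : 0.69 ≤ b) (hs : 1 / 4 ≤ s)
    (hu : 2 ≤ u) (hn0 : 0 ≤ n) (hr : r ≤ 3 * b) (hn : n ≤ 10 ^ 8 * (u * s))
    (hm : m ≤ 2048 * s * (9 * b + 2 * (n * a)) + 2) :
    r * n + m ≤ 10 ^ 14 * (u * s * s * (a * b)) := by
  have hus : 1 / 2 ≤ u * s := by nlinarith
  have h1 : r * n ≤ 3 * b * (10 ^ 8 * (u * s)) :=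
    mul_le_mul hr hn hn0 (by linarith)
  have hsa : 1 ≤ 6 * (s * a) := by nlinarith
  have h2 : b * (u * s) ≤ 6 * (u * s * s * (a * b)) := by
    have : 0 ≤ b * (u * s) := mul_nonneg (by linarith) (by linarith)
    nlinarith
  have h4 : s * (n * a) ≤ s * (10 ^ 8 * (u * s) * a) :=
    mul_le_mul_of_nonneg_left (mul_le_mul_of_nonneg_right hn (by linarith)) (by linarith)
  have h5 : s * (10 ^ 8 * (u * s) * a) ≤ 1.5 * 10 ^ 8 * (u * s * s * (a * b)) := by
    have : 0 ≤ u * s * s * a :=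
      mul_nonneg (mul_nonneg (by linarith) (by linarith)) (by linarith)
    nlinarith
  have h6 : s * b ≤ b * (u * s) := by
    have : 0 ≤ s * b := mul_nonneg (by linarith) (by linarith)
    nlinarith
  have h7 : 1 ≤ 4 * (b * (u * s)) := by nlinarith
  linarith

lemma exists_sampleSize : ∃ K : ℝ, 0 < K ∧ ∀ (d k : ℕ) (ε δ : ℝ), 1 ≤ d → 2 ≤ k → 0 < ε →
    ε < 2 → 0 < δ → δ < 1 → ∃ r n m : ℕ, 0 < r ∧ 0 < m ∧
      6400 * (((1 + (d + d * d)) * k : ℕ) : ℝ) ≤ (ε / 64) ^ 2 * n ∧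
      (1 / 2 : ℝ) ^ r + 2 * (r * k ^ n) ^ 2 * Real.exp (-2 * m * (ε / 64) ^ 2) ≤ δ ∧
      ((r * n + m : ℕ) : ℝ) ≤
        K * ((k : ℝ) * (d : ℝ) ^ 2 * Real.log k * Real.log (k / δ) / ε ^ 4) := by
  refine ⟨10 ^ 14, by norm_num, fun d k ε δ hd hk hε hε2 hδ hδ1 => ?_⟩
  have hd1 : (1 : ℝ) ≤ d := by exact_mod_cast hd
  have hk2 : (2 : ℝ) ≤ k := by exact_mod_cast hk
  have hlog2 := Real.log_two_gt_d9
  set a := Real.log k with ha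
  set b := Real.log (k / δ) with hb
  have ha0 : 0.69 ≤ a := by
    have := Real.log_le_log (by norm_num) hk2
    linarith
  have hb2 : Real.log (2 / δ) ≤ b := Real.log_le_log (by positivity) (by gcongr)
  have hlogδ : 0 ≤ Real.log (1 / δ) := Real.log_nonneg (by rw [le_div_iff₀ hδ]; linarith)
  have hlog2δ : Real.log (2 / δ) = Real.log 2 + Real.log (1 / δ) := by
    rw [← Real.log_mul (by norm_num) (by positivity)]; congr 1; ring
  have hb0 : 0.69 ≤ b := by linarith
  set s := 1 / ε ^ 2 with hs
  have hs0 : 1 / 4 ≤ s := by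
    rw [hs]; gcongr; nlinarith
  have hsε : s * ε ^ 2 = 1 := by rw [hs]; field_simp
  set u : ℝ := k * d ^ 2 with hu
  have hu2 : 2 ≤ u := by nlinarith [sq_nonneg (d : ℝ)]
  set V : ℝ := (((1 + (d + d * d)) * k : ℕ) : ℝ) with hV
  have hVu : V ≤ 3 * u := by
    rw [hV, hu]; push_cast
    have : 1 + ((d : ℝ) + d * d) ≤ 3 * d ^ 2 := by nlinarith
    nlinarith
  have hV0 : 0 ≤ V := Nat.cast_nonneg _
  -- `r` and `m` each bring one of the two failure terms below `δ / 2`, and `n` meets the VC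
  -- condition. With `τ = ε / 64`, the factors are `4096 = 64²` and `2048 = 64² / 2`.
  set r := ⌈Real.log (2 / δ) / Real.log 2⌉₊ with hr
  set n := ⌈6400 * 4096 * V * s⌉₊ with hn
  set m := ⌈2048 * s * Real.log (4 * (r * k ^ n) ^ 2 / δ)⌉₊ + 1 with hm
  have hr0 : 0 < r := Nat.ceil_pos.2 (div_pos (by linarith) (by linarith))
  have hr1 : (1 : ℝ) ≤ r := by exact_mod_cast hr0
  have hrb : (r : ℝ) ≤ 3 * b := by
    have h1 := Nat.ceil_lt_add_one (a := Real.log (2 / δ) / Real.log 2)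
      (div_nonneg (by linarith) (by linarith))
    have h2 : Real.log (2 / δ) / Real.log 2 ≤ 1.5 * b := by
      rw [div_le_iff₀ (by linarith)]; nlinarith
    linarith
  have hnn : (n : ℝ) ≤ 10 ^ 8 * (u * s) := by
    have h1 := Nat.ceil_lt_add_one (a := 6400 * 4096 * V * s) (by positivity)
    have h2 : V * s ≤ 3 * u * s := by gcongr
    have h3 : 1 / 2 ≤ u * s := by nlinarith
    linarith
  have hk0 : (0 : ℝ) < k := by linarith
  have hlogm : Real.log (4 * (r * k ^ n) ^ 2 / δ) ≤ 9 * b + 2 * (n * a) := by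
    have h1 : Real.log (4 * (r * k ^ n) ^ 2 / δ) =
        2 * Real.log 2 + Real.log (1 / δ) + 2 * (Real.log r + n * a) := by
      rw [show 4 * ((r : ℝ) * k ^ n) ^ 2 / δ = 2 ^ 2 * (1 / δ) * (r * k ^ n) ^ 2 by ring,
        Real.log_mul (by positivity) (by positivity), Real.log_mul (by positivity) (by positivity),
        Real.log_pow, Real.log_pow, Real.log_mul (by positivity) (by positivity), Real.log_pow]
      push_cast; ring
    have h2 := Real.log_le_sub_one_of_pos (show (0 : ℝ) < r by linarith)
    linarith
  have hexpm : Real.log (4 * (r * k ^ n) ^ 2 / δ) ≤ 2 * m * (ε / 64) ^ 2 := by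
    have h1 : 2048 * s * Real.log (4 * (r * k ^ n) ^ 2 / δ) ≤ m := by
      rw [hm]; push_cast; linarith [Nat.le_ceil (2048 * s * Real.log (4 * (r * k ^ n) ^ 2 / δ))]
    calc Real.log (4 * (r * k ^ n) ^ 2 / δ)
        = (s * ε ^ 2) * Real.log (4 * (r * k ^ n) ^ 2 / δ) := by rw [hsε, one_mul]
      _ = 2 * (2048 * s * Real.log (4 * (r * k ^ n) ^ 2 / δ)) * (ε / 64) ^ 2 := by ring
      _ ≤ _ := by gcongr
  refine ⟨r, n, m, hr0, Nat.succ_pos _, ?_, ?_, ?_⟩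
  · have h1 := Nat.le_ceil (6400 * 4096 * V * s)
    calc 6400 * V = (s * ε ^ 2) * (6400 * V) := by rw [hsε, one_mul]
      _ = (ε / 64) ^ 2 * (6400 * 4096 * V * s) := by ring
      _ ≤ (ε / 64) ^ 2 * n := by gcongr
  · have h1 : (1 / 2 : ℝ) ^ r ≤ δ / 2 := by
      have h2 := Nat.le_ceil (Real.log (2 / δ) / Real.log 2)
      rw [div_le_iff₀ (by linarith), ← Real.log_pow] at h2
      have h3 := (Real.log_le_log_iff (by positivity) (by positivity)).1 h2
      rw [one_div, inv_pow, ← inv_div]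
      exact inv_anti₀ (by positivity) h3
    have h2 : 2 * (r * k ^ n) ^ 2 * Real.exp (-2 * m * (ε / 64) ^ 2) ≤ δ / 2 := by
      have h3 : Real.exp (-2 * m * (ε / 64) ^ 2) ≤ (4 * (r * k ^ n) ^ 2 / δ)⁻¹ := by
        rw [← Real.exp_log (show 0 < 4 * ((r : ℝ) * k ^ n) ^ 2 / δ by positivity), ← Real.exp_neg]
        apply Real.exp_le_exp.2
        linarith
      calc _ ≤ 2 * ((r : ℝ) * k ^ n) ^ 2 * (4 * ((r : ℝ) * k ^ n) ^ 2 / δ)⁻¹ := by gcongr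
        _ = δ / 2 := by field_simp; norm_num
    linarith
  · have hε4 : u * a * b / ε ^ 4 = u * s * s * (a * b) := by
      rw [hs]; ring
    have h3 : (m : ℝ) ≤ 2048 * s * (9 * b + 2 * (n * a)) + 2 := by
      have h4 : 2048 * s * Real.log (4 * (r * k ^ n) ^ 2 / δ) ≤
          2048 * s * (9 * b + 2 * (n * a)) :=
        mul_le_mul_of_nonneg_left hlogm (mul_nonneg (by norm_num) (by linarith))
      have h5 : 0 ≤ 2048 * s * Real.log (4 * (r * k ^ n) ^ 2 / δ) := by
        refine mul_nonneg (mul_nonneg (by norm_num) (by linarith)) (Real.log_nonneg ?_)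
        rw [le_div_iff₀ hδ]
        have : (1 : ℝ) ≤ (r * k ^ n) ^ 2 :=
          one_le_pow₀ (one_le_mul_of_one_le_of_one_le hr1 (one_le_pow₀ (by linarith)))
        linarith
      have h7 := Nat.ceil_lt_add_one h5
      rw [hm]; push_cast; linarith
    rw [hε4]
    push_cast
    exact sampleSize_arith ha0 hb0 hs0 hu2 (Nat.cast_nonneg n) hrb hnn h3

/-! ### Assembly of the learner. -/

/-- For every accuracy and confidence there is a measurable estimator with the required sample
size. -/
lemma exists_estimator : ∃ K : ℝ, 0 < K ∧ ∀ (d k : ℕ), 1 ≤ d → 2 ≤ k → ∀ ε δ : ℝ, 0 < ε → 0 < δ →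
    ∃ (N : ℕ) (T : (Fin N → EuclideanSpace ℝ (Fin d)) →
        ProbabilityMeasure (EuclideanSpace ℝ (Fin d))), Measurable T ∧
      (∀ g, sampleLaw g N {S | ¬ IsAgnosticApprox (mixtures (gaussians d) k) ε 9 (T S) g} ≤
        ENNReal.ofReal δ) ∧
      (δ < 1 → (N : ℝ) ≤
        K * ((k : ℝ) * (d : ℝ) ^ 2 * Real.log k * Real.log (k / δ) / ε ^ 4)) := by
  obtain ⟨K, hK, hsize⟩ := exists_sampleSize
  refine ⟨K, hK, fun d k hd hk ε δ hε hδ => ?_⟩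
  obtain ⟨f, -⟩ := mixtures_gaussians_nonempty d (by omega : 0 < k)
  have hk2 : (2 : ℝ) ≤ k := by exact_mod_cast hk
  rcases le_or_gt 1 δ with hδ1 | hδ1
  · refine ⟨0, fun _ => f, measurable_const, fun g => ?_, fun h => absurd h (not_lt.2 hδ1)⟩
    have : IsProbabilityMeasure (sampleLaw g 0) := by unfold sampleLaw; infer_instance
    exact prob_le_one.trans (by simpa using hδ1)
  -- The `L¹` distance never exceeds `2`, so a constant output without samples is enough.
  rcases le_or_gt 2 ε with hε2 | hε2
  · refine ⟨0, fun _ => f, measurable_const, fun g => ?_, fun _ => ?_⟩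
    · have : {S : Fin 0 → EuclideanSpace ℝ (Fin d) |
          ¬ IsAgnosticApprox (mixtures (gaussians d) k) ε 9 f g} = ∅ := by
        ext S
        simp only [Set.mem_ofPred_eq, Set.mem_empty_iff_false, iff_false, not_not]
        have h1 := opt_nonneg (mixtures (gaussians d) k) g
        have h2 := tvDist_le_one f g
        simp only [IsAgnosticApprox, l1Dist]
        linarith
      rw [this, measure_empty]
      exact zero_le
    · have h1 : 0 ≤ Real.log k := Real.log_nonneg (by linarith)
      have h2 : 0 ≤ Real.log (k / δ) := Real.log_nonneg (by rw [le_div_iff₀ hδ]; linarith)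
      rw [Nat.cast_zero]
      positivity
  · obtain ⟨r, n, m, hr, hm, hn, hprob, hN⟩ := hsize d k ε δ hd hk hε hε2 hδ hδ1
    obtain ⟨T, hT, hTg⟩ := exists_mixture_estimator d (by omega : 0 < k) (by positivity) hr hm hn
    refine ⟨r * n + m, T, hT, fun g => ?_, fun _ => hN⟩
    have := (hTg g).trans (ENNReal.ofReal_le_ofReal hprob)
    rwa [mul_div_cancel₀ _ (by norm_num : (64 : ℝ) ≠ 0)] at this

lemma opt_eq_zero_of_mem {X : Type*} [MeasurableSpace X] {F : Set (ProbabilityMeasure X)}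
    {g : ProbabilityMeasure X} (hg : g ∈ F) : opt F g = 0 := by
  refine le_antisymm ?_ (opt_nonneg F g)
  refine (ciInf_le ⟨0, ?_⟩ (⟨g, hg⟩ : F)).trans (le_of_eq ?_)
  · rintro _ ⟨f, rfl⟩
    exact mul_nonneg zero_le_two (tvDist_nonneg f.1 g)
  · have : tvDist g g ≤ 0 := tvDist_le fun B _ => by simp
    simp only [l1Dist]
    linarith [tvDist_nonneg g g]

lemma IsAgnosticPACLearner.isRealizablePACLearner {X : Type*} [MeasurableSpace X] {C : ℝ}
    {F : Set (ProbabilityMeasure X)} {m : ℝ → ℝ → ℕ} {A : Learner X}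
    (h : IsAgnosticPACLearner C F m A) : IsRealizablePACLearner F m A := by
  intro g hg ε δ hε hδ
  have := h g ε δ hε hδ
  simpa only [IsAgnosticApprox, IsApprox, opt_eq_zero_of_mem hg, mul_zero, zero_add] using this

end DistLearning

end

theorem mainTheorem7 :
    ∃ K : ℝ, 0 < K ∧ ∀ d k : ℕ, 1 ≤ d → 2 ≤ k →
      ∃ (m : ℝ → ℝ → ℕ) (A : DistLearning.Learner (EuclideanSpace ℝ (Fin d))),
        DistLearning.IsAgnosticPACLearner 9
          (DistLearning.mixtures (DistLearning.gaussians d) k) m A ∧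
        DistLearning.IsRealizablePACLearner
          (DistLearning.mixtures (DistLearning.gaussians d) k) m A ∧
        ∀ ε δ : ℝ, 0 < ε → 0 < δ → δ < 1 →
          (m ε δ : ℝ) ≤
            K * ((k : ℝ) * (d : ℝ) ^ 2 * Real.log k * Real.log (k / δ) / ε ^ 4) := by
  obtain ⟨K, hK, hest⟩ := DistLearning.exists_estimator
  refine ⟨K, hK, fun d k hd hk => ?_⟩
  choose! m T hT hTg hm using hest d k hd hk
  obtain ⟨f, -⟩ := DistLearning.mixtures_gaussians_nonempty d (by omega : 0 < k)
  classical
  let A : DistLearning.Learner (EuclideanSpace ℝ (Fin d)) :=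
    { output := fun ε δ n S =>
        -- A learner must accept every sample size; away from the prescribed one it returns a fixed
        -- mixture, which the guarantee never sees.
        if h : 0 < ε ∧ 0 < δ ∧ n = m ε δ then T ε δ fun i => S (Fin.cast h.2.2.symm i) else f
      measurable_output := fun ε δ n => by
        by_cases h : 0 < ε ∧ 0 < δ ∧ n = m ε δ
        · simp only [h]
          exact (hT ε δ h.1 h.2.1).comp (measurable_pi_iff.2 fun i => measurable_pi_apply _)
        · simp only [h, dite_false]
          exact measurable_const }
  have hA : DistLearning.IsAgnosticPACLearner 9
      (DistLearning.mixtures (DistLearning.gaussians d) k) m A := by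
    intro g ε δ hε hδ
    have hout : ∀ S, A.output ε δ (m ε δ) S = T ε δ S := fun S => by
      simp only [A, hε, hδ, true_and, dite_true]
      rfl
    simp only [hout]
    exact hTg ε δ hε hδ g
  exact ⟨m, A, hA, hA.isRealizablePACLearner, fun ε δ hε hδ hδ1 => hm ε δ hε hδ hδ1⟩
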